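/- An assignment-packing problem has variables $X_1,\dots,X_n$, where $X_i$ takes values in a finite set $L_i$, and $m$ constraints $\sum_{i,j} a_{k,i,j}[X_i=j]\le b_k$ with $a_{k,i,j}\in[0,1]$. A fractional solution with right-hand side $c$ is $z\ge 0$ with $\sum_{j\in L_i} z_{i,j}=1$ for all $i$ and $\sum_{i,j}a_{k,i,j}z_{i,j}\le c_k$ for all $k$. The Partial Resampling Algorithm (PRA) for $(z,b)$ works as follows. Elements are pairs $(i,j)$ with $j\in L_i$; a set $B$ of elements is true if $X_i=j$ for all $(i,j)\in B$. Let $\mathcal B_k$ be the family of sets $B$ of elements with no two elements of the same variable, with $a_{k,x}>0$ for all $x\in B$ and $\sum_{x\in B}a_{k,x}>b_k$. For each $k$ let $Q_k$ be a fractional hitting-set for $\mathcal B_k$, that is, a function from sets of elements to $[0,1]$ with $\sum_{Y\subseteq B}Q_k(Y)\ge 1$ for all $B\in\mathcal B_k$. All variables are first drawn independently with $P(X_i=j)=z_{i,j}$. While some $B\in\bigcup_k\mathcal B_k$ is true, an arbitrary rule (which may depend on the past) selects $k$ and a true $B\in\mathcal B_k$; then $Y\subseteq B$ is selected with probability $Q_k(Y)/\sum_{Y'\subseteq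 B}Q_k(Y')$, and the variables occurring in $Y$ are redrawn independently from $z$. The Moser-Tardos (MT) algorithm for $(z,b)$ has the same initial draw; while some constraint is violated, an arbitrary rule (which may depend on the past) selects a violated constraint $k$, and all variables $i$ with $a_{k,i,j}>0$ for some $j$ are redrawn independently from $z$. A step is one resampling. **Proposition.** There are universal constants $C,c_1,c_2>0$ and a universal polynomial $P$ such that for all real $1\le R\le R'$ there are $\phi,\phi'>0$ and $M$, depending only on $R,R'$, such that for every integer $m\ge M$ there are an assignment-packing problem with $n$ variables and $m$ constraints, in which every variable has exactly $m$ values and all $a_{k,i,j}\in\{0,1\}$, and a fractional assignment $z$, namely $z_{i,j}=1/m$, with the following properties. 1. $c_1Rm\le n\le c_2Rm$. 2. $z$ is a fractional solution with right-hand side $c_k=R$ for all $k$. 3. For every variable $i$ and value $j$ there is exactly one $k$ with $a_{k,i,j}>0$. 4. For $b_k=R+C\sqrt R$ there are fractional hitting-sets $Q_k$ for the $\mathcal B_k$ such that, for every selection rule, the expected number of resamplings of the PRA for $(z,b)$ is at most $P(n+m)$. Moreover, this PRA can be implemented (with a suitable selection rule) in expected polynomial time: for a suitable $d$, the program that in each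 pass scans the constraints until it finds a violated one, takes as $B$ all the elements of this constraint that are present in the current assignment, selects a uniformly random $d$-element subset $Y$ of $B$ by sequential sampling, and redraws the variables of $Y$, carries out the PRA for $(z,b)$ and $(Q_k)$, and the expected number of its elementary steps (memory accesses, integer additions and comparisons, list and counter operations, random draws of an integer) until it halts is at most $P(n+m)$. 5. For $b_k=R'$ and every selection rule, the probability that the MT algorithm for $(z,b)$ terminates within $t$ steps is at most $2^{-\phi' m}$, for every integer $0\le t\le 2^{\phi m}$. -/

import Mathlib

open scoped NNReal ENNReal

/-! Assignment-packing problems, the Partial Resampling Algorithm (PRA), a step-counted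
implementation of it, and the Moser-Tardos (MT) algorithm. -/

noncomputable section

namespace PartialResampling

/-- An assignment-packing problem with variables `X_i`, `i : Fin n`, and packing constraints
indexed by `k : Fin m`.  Variable `i` takes its values in a finite set, which is identified with
`Fin (numVals i)`; the constraint `k` bounds `∑_{i,j} coeff k i j * [X_i = j]`. -/
structure AssignmentPacking (n m : ℕ) where
  numVals : Fin n → ℕ
  coeff : Fin m → (i : Fin n) → Fin (numVals i) → ℝ
  coeff_mem : ∀ k i j, coeff k i j ∈ Set.Icc (0 : ℝ) 1

namespace AssignmentPacking

variable {n m : ℕ} (A : AssignmentPacking n m)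

/-- An integral assignment: one value for each variable. -/
abbrev Config : Type := (i : Fin n) → Fin (A.numVals i)

/-- An element: a variable together with one of its values. -/
abbrev Elem : Type := (i : Fin n) × Fin (A.numVals i)

/-- The left-hand side `∑_{i,j} a_{k,i,j} [X_i = j]` of constraint `k`. -/
def load (k : Fin m) (X : A.Config) : ℝ := ∑ i, A.coeff k i (X i)

/-- `X` satisfies all packing constraints with right-hand side `b`. -/
def Feasible (b : Fin m → ℝ) (X : A.Config) : Prop := ∀ k, A.load k X ≤ b k

/-- A fractional assignment: `z_{i,j} ≥ 0` and `∑_j z_{i,j} = 1` for every variable `i`. -/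
structure FractionalAssignment where
  val : (i : Fin n) → Fin (A.numVals i) → ℝ
  nonneg : ∀ i j, 0 ≤ val i j
  sum_eq_one : ∀ i, ∑ j, val i j = 1

variable {A}

/-- The fractional assignment satisfies every packing constraint with right-hand side `c`. -/
def FractionalAssignment.Achieves (z : A.FractionalAssignment) (c : Fin m → ℝ) : Prop :=
  ∀ k, ∑ i, ∑ j, A.coeff k i j * z.val i j ≤ c k

/-- The distribution of variable `i` with `P(X_i = j) = z_{i,j}`. -/
def FractionalAssignment.law (z : A.FractionalAssignment) (i : Fin n) :
    PMF (Fin (A.numVals i)) :=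
  PMF.ofFintype (fun j => ENNReal.ofReal (z.val i j)) (by
    rw [← ENNReal.ofReal_sum_of_nonneg (fun j _ => z.nonneg i j), z.sum_eq_one i,
      ENNReal.ofReal_one])

end AssignmentPacking

open AssignmentPacking

/-- The product distribution: the coordinates are independent, the `i`-th has law `μ i`. -/
def productLaw {ι : Type} [Fintype ι] [DecidableEq ι] {α : ι → Type} [∀ i, Fintype (α i)]
    (μ : (i : ι) → PMF (α i)) : PMF ((i : ι) → α i) :=
  PMF.ofFintype (fun x => ∏ i, μ i (x i)) (by
    have h := Finset.prod_univ_sum (fun i => (Finset.univ : Finset (α i))) (fun i j => μ i j)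
    rw [Fintype.piFinset_univ] at h
    rw [← h]
    refine Finset.prod_eq_one fun i _ => ?_
    have h1 := (μ i).tsum_coe
    rwa [tsum_fintype] at h1)

variable {n m : ℕ} {A : AssignmentPacking n m}

/-- Draw all the variables in `S` afresh and independently, and keep the others. -/
def resample (z : A.FractionalAssignment) (X : A.Config) (S : Finset (Fin n)) : PMF A.Config :=
  productLaw fun i => if i ∈ S then z.law i else PMF.pure (X i)

/-- The initial draw of all variables. -/
def initialLaw (z : A.FractionalAssignment) : PMF A.Config := productLaw fun i => z.law i

/-! ### The Partial Resampling Algorithm -/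

/-- The atomic event `B` (the conjunction of `X_i = j` over `(i, j) ∈ B`) is true on `X`. -/
def Occurs (B : Finset A.Elem) (X : A.Config) : Prop := ∀ x ∈ B, X x.1 = x.2

/-- The atomic bad-events into which the violation `∑_{i,j} a_{k,i,j} [X_i = j] > b_k` of
constraint `k` is decomposed: sets of elements, with no two values for the same variable, that
have positive coefficients in row `k` and whose coefficients add up to more than `b_k`. -/
def badEvents (A : AssignmentPacking n m) (b : Fin m → ℝ) (k : Fin m) : Set (Finset A.Elem) :=
  {B | (∀ x ∈ B, ∀ y ∈ B, x.1 = y.1 → x = y) ∧ (∀ x ∈ B, 0 < A.coeff k x.1 x.2) ∧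
    b k < ∑ x ∈ B, A.coeff k x.1 x.2}

/-- `Q` is a fractional hitting-set for the family `𝓑` of atomic events. -/
def IsFractionalHittingSet (Q : Finset A.Elem → ℝ≥0) (𝓑 : Set (Finset A.Elem)) : Prop :=
  (∀ Y, Q Y ≤ 1) ∧ ∀ B ∈ 𝓑, 1 ≤ ∑ Y ∈ B.powerset, Q Y

/-- The choice of the resampled set: `Y ⊆ B` is selected with probability
`Q(Y) / ∑_{Y' ⊆ B} Q(Y')`.  (If the denominator is zero, a case that does not arise when `Q` is a
fractional hitting-set and `B` is a bad-event, `B` itself is returned.) -/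
def selectSubset (Q : Finset A.Elem → ℝ≥0) (B : Finset A.Elem) : PMF (Finset A.Elem) :=
  if h : ∑ Y ∈ B.powerset, Q Y = 0 then PMF.pure B
  else PMF.ofFinset
    (fun Y => if Y ∈ B.powerset then ((Q Y / ∑ Y' ∈ B.powerset, Q Y' : ℝ≥0) : ℝ≥0∞) else 0)
    B.powerset
    (by
      rw [Finset.sum_congr rfl (fun Y hY => if_pos hY), ← ENNReal.ofNNReal_finsetSum,
        ← Finset.sum_div, div_self h, ENNReal.coe_one])
    (fun Y hY => if_neg hY)

/-- One resampling of the PRA on the configuration `X`, when `B` is the violated set and `Q` is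
the fractional hitting-set of its label; the resampled set is returned as well. -/
def praMove (z : A.FractionalAssignment) (Q : Finset A.Elem → ℝ≥0) (B : Finset A.Elem)
    (X : A.Config) : PMF (Finset A.Elem × A.Config) :=
  (selectSubset Q B).bind fun Y =>
    (resample z X (Y.image Sigma.fst)).map fun X' => (Y, X')

/-- The past of a PRA run: the earlier configurations and the sets resampled on them, the latest
one first. -/
abbrev PRAHistory (A : AssignmentPacking n m) : Type := List (A.Config × Finset A.Elem)

/-- A rule for the arbitrary selection of a true bad-event (and its label); it may depend on the
whole past. -/
abbrev PRARule (A : AssignmentPacking n m) : Type :=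
  PRAHistory A → A.Config → Fin m × Finset A.Elem

/-- Some atomic bad-event is true on `X`. -/
def SomeBadEvent (b : Fin m → ℝ) (X : A.Config) : Prop :=
  ∃ k, ∃ B ∈ badEvents A b k, Occurs B X

/-- As long as there is a true bad-event, the rule selects one. -/
def PRARule.Valid (σ : PRARule A) (b : Fin m → ℝ) : Prop :=
  ∀ h X, SomeBadEvent b X →
    (σ h X).2 ∈ badEvents A b (σ h X).1 ∧ Occurs (σ h X).2 X

open Classical in
/-- The law of the history and the current configuration of the PRA after `t` resamplings (or
after termination, if that comes earlier). -/
def praLaw (z : A.FractionalAssignment) (b : Fin m → ℝ) (Q : Fin m → Finset A.Elem → ℝ≥0)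
    (σ : PRARule A) : ℕ → PMF (PRAHistory A × A.Config)
  | 0 => (initialLaw z).map fun X => ([], X)
  | t + 1 => (praLaw z b Q σ t).bind fun s =>
      if SomeBadEvent b s.2 then
        (praMove z (Q (σ s.1 s.2).1) (σ s.1 s.2).2 s.2).map fun r => ((s.2, r.1) :: s.1, r.2)
      else PMF.pure s

/-- The expected number of resamplings of the PRA, as the sum over `t` of the probability that
there is a resampling number `t + 1`. -/
def praExpectedResamplings (z : A.FractionalAssignment) (b : Fin m → ℝ)
    (Q : Fin m → Finset A.Elem → ℝ≥0) (σ : PRARule A) : ℝ≥0∞ :=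
  ∑' t : ℕ, (praLaw z b Q σ t).toOuterMeasure {s | SomeBadEvent b s.2}

/-! ### Randomized computations with a step count -/

/-- A randomized computation: the joint law of its result and of its number of elementary
steps. -/
def Timed (α : Type) : Type := PMF (α × ℕ)

namespace Timed

/-- The joint law of result and step count. -/
def run {α : Type} (x : Timed α) : PMF (α × ℕ) := x

/-- Sequential composition adds up the step counts; `pure` is free. -/
instance : Monad Timed where
  pure a := PMF.pure (a, 0)
  bind x f := PMF.bind x.run fun r => PMF.map (fun s => (s.1, r.2 + s.2)) (f r.1).run

/-- One deterministic elementary operation (reading or writing a memory cell, pushing to a list,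
an addition or comparison of integers, the advance of a loop counter), with result `a`. -/
def op {α : Type} (a : α) : Timed α := PMF.pure (a, 1)

/-- One elementary random draw. -/
def draw {α : Type} (μ : PMF α) : Timed α := PMF.map (fun a => (a, 1)) μ

/-- The law of the result alone. -/
def law {α : Type} (x : Timed α) : PMF α := PMF.map Prod.fst x.run

/-- The expected number of steps. -/
def expectedSteps {α : Type} (x : Timed α) : ℝ≥0∞ := ∑' r : α × ℕ, x.run r * (r.2 : ℝ≥0∞)

end Timed

/-! ### A step-counted implementation of the PRA for matrices with entries 0 and 1

The configuration is an array of `n` values.  The right-hand sides are given as integer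
thresholds `T k`, and `d` is the number of elements that are resampled at a time. -/

/-- Run through a list of variables; collect the elements `(i, X_i)` with coefficient 1 in row `k`
and count them. -/
def scanRow (A : AssignmentPacking n m) (X : A.Config) (k : Fin m) :
    List (Fin n) → Timed (List A.Elem × ℕ)
  | [] => Timed.op ([], 0)
  | i :: l => do
      let r ← scanRow A X k l
      let v ← Timed.op (X i)
      let a ← Timed.op (A.coeff k i v)
      let hit ← Timed.op (@decide (a = 1) (Classical.propDecidable _))
      if hit then do
        let B ← Timed.op (⟨i, v⟩ :: r.1)
        let c ← Timed.op (r.2 + 1)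
        pure (B, c)
      else pure r

/-- Run through a list of rows until one is found with more than `T k` ones; return the elements
of that row that are present in `X`. -/
def findViolated (A : AssignmentPacking n m) (T : Fin m → ℕ) (X : A.Config) :
    List (Fin m) → Timed (Option (List A.Elem))
  | [] => Timed.op none
  | k :: l => do
      let r ← scanRow A X k (List.finRange n)
      let threshold ← Timed.op (T k)
      let bad ← Timed.op (decide (threshold < r.2))
      if bad then Timed.op (some r.1) else findViolated A T X l

/-- Select `d` members of a list: the current head is taken with probability
`d / (length of the remaining list)`, where `d` is the number of members still needed.  The
length of the remaining list is kept in a counter. -/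
def chooseSublist {α : Type} : List α → ℕ → Timed (List α)
  | [], _ => Timed.op []
  | x :: l, d => do
      let remaining ← Timed.op l.length
      let u ← Timed.draw (PMF.uniformOfFintype (Fin (remaining + 1)))
      let take ← Timed.op (decide ((u : ℕ) < d))
      if take then do
        let d' ← Timed.op (d - 1)
        let Y ← chooseSublist l d'
        Timed.op (x :: Y)
      else chooseSublist l d

/-- Draw the variables of the listed elements afresh and write them to the configuration. -/
def resampleList (z : A.FractionalAssignment) : List A.Elem → A.Config → Timed A.Config
  | [], X => Timed.op X
  | x :: l, X => do
      let i ← Timed.op x.1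
      let v ← Timed.draw (z.law i)
      let X' ← Timed.op (Function.update X i v)
      resampleList z l X'

/-- One pass of the main loop; the result `none` means that no constraint is violated. -/
def praPass (z : A.FractionalAssignment) (T : Fin m → ℕ) (d : ℕ) (X : A.Config) :
    Timed (Option A.Config) := do
  match ← findViolated A T X (List.finRange m) with
  | none => pure none
  | some B => do
      let Y ← chooseSublist B d
      let X' ← resampleList z Y X
      pure (some X')

/-- Draw the listed variables and then return the whole configuration. -/
def drawList (z : A.FractionalAssignment) : List (Fin n) → A.Config → Timed A.Config
  | [], X => Timed.op X
  | i :: l, X => do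
      let v ← Timed.draw (z.law i)
      let X' ← Timed.op (Function.update X i v)
      drawList z l X'

/-- The state of the program after at most `t` passes of the main loop; the flag is `true` when
the program has halted.  `X₀` is the initial content of the memory, which is overwritten. -/
def praProgram (z : A.FractionalAssignment) (T : Fin m → ℕ) (d : ℕ) (X₀ : A.Config) :
    ℕ → Timed (A.Config × Bool)
  | 0 => do
      let X ← drawList z (List.finRange n) X₀
      pure (X, false)
  | t + 1 => do
      let s ← praProgram z T d X₀ t
      if s.2 then pure s
      else do
        match ← praPass z T d s.1 with
        | none => pure (s.1, true)
        | some X' => pure (X', false)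

/-- The expected running time: the expected number of elementary steps until the program halts,
as the limit of the (nondecreasing) expected numbers of steps in the first `t` passes. -/
def praExpectedTime (z : A.FractionalAssignment) (T : Fin m → ℕ) (d : ℕ) (X₀ : A.Config) :
    ℝ≥0∞ :=
  ⨆ t : ℕ, (praProgram z T d X₀ t).expectedSteps

/-- The program carries out the PRA with the bad-events of the right-hand side `b` and with the
hitting-sets `Q`: it starts with an independent draw of all variables; a pass on `X` stops if no
bad-event is true on `X`, and otherwise it performs, for some true bad-event, one resampling of
the PRA. -/
def ImplementsPRA (z : A.FractionalAssignment) (b : Fin m → ℝ)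
    (Q : Fin m → Finset A.Elem → ℝ≥0) (T : Fin m → ℕ) (d : ℕ) : Prop :=
  (∀ X₀ : A.Config, (drawList z (List.finRange n) X₀).law = initialLaw z) ∧
  ∀ X : A.Config,
    (¬ SomeBadEvent b X → (praPass z T d X).law = PMF.pure none) ∧
    (SomeBadEvent b X → ∃ k, ∃ B ∈ badEvents A b k, Occurs B X ∧
      (praPass z T d X).law = (praMove z (Q k) B X).map fun r => some r.2)

/-! ### The Moser-Tardos algorithm -/

open Classical in
/-- The variables on which constraint `k` depends. -/
def rowVars (A : AssignmentPacking n m) (k : Fin m) : Finset (Fin n) :=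
  Finset.univ.filter fun i => ∃ j, 0 < A.coeff k i j

/-- A rule for the arbitrary selection of a violated constraint; it may depend on the earlier
configurations (the latest one first). -/
abbrev MTRule (A : AssignmentPacking n m) : Type := List A.Config → A.Config → Fin m

/-- As long as some constraint is violated, the rule selects a violated one. -/
def MTRule.Valid (σ : MTRule A) (b : Fin m → ℝ) : Prop :=
  ∀ h X, ¬ A.Feasible b X → b (σ h X) < A.load (σ h X) X

open Classical in
/-- The law of the history and the current configuration of the MT algorithm after `t` resamplings
(or after termination, if that comes earlier); there is one bad-event for each constraint, and
all variables on which the selected constraint depends are resampled. -/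
def mtLaw (z : A.FractionalAssignment) (b : Fin m → ℝ) (σ : MTRule A) :
    ℕ → PMF (List A.Config × A.Config)
  | 0 => (initialLaw z).map fun X => ([], X)
  | t + 1 => (mtLaw z b σ t).bind fun s =>
      if A.Feasible b s.2 then PMF.pure s
      else (resample z s.2 (rowVars A (σ s.1 s.2))).map fun X' => (s.2 :: s.1, X')

/-- The probability that the MT algorithm terminates within `t` resamplings. -/
def mtTerminationProb (z : A.FractionalAssignment) (b : Fin m → ℝ) (σ : MTRule A) (t : ℕ) :
    ℝ≥0∞ :=
  (mtLaw z b σ t).toOuterMeasure {s | A.Feasible b s.2}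

end PartialResampling

end

open PartialResampling

noncomputable section

namespace PartialResampling

open AssignmentPacking

/-! The example is balls in bins: `n = ⌊R * m⌋` balls are thrown uniformly into `m` bins, and
constraint `k` bounds the load of bin `k`, whose mean is `n / m ≤ R`.

The PRA is fast because it may redraw a single ball. Let `T = ⌊R + 2√R⌋`, so that `T ≥ R + 1`. With
equal weights `1 / (T + 1)` on all singletons, the PRA rethrows a uniformly random ball of the
selected bad-event. That ball leaves a bin with more than `T` balls, so the total excess over `T`
drops by 1; it rises again by 1 only if the ball lands in a bin with at least `T` balls. There are
at most `n / T` such bins, so `T` times the excess falls on average by at least `T - n / m ≥ 1`,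
whichever bad-event is selected (`sum_excess_update_add_le`, `expect_excess_praMove`). Since this
potential is at most `T * n`, telescoping bounds the number of resamplings
(`praExpectedResamplings_le`); weighting it by the cost of a pass bounds the running time
(`praExpectedTime_le`).

MT is slow because every constraint depends on every ball: each resampling is a completely fresh
draw, and termination within `t` steps has probability at most `(t + 1) * p`, where `p` is the
probability that a single draw is feasible (`mtTerminationProb_le`). Counting assignments by the
generating function of a bin gives `p ≤ n! * E ^ m / (R * m) ^ n`, where `E` is the exponential
series at `R` cut off after degree `⌊R'⌋` (`card_boundedFibers_mul_pow_le`). By Stirling this is a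
linear factor in `m` times `(E * exp (-R)) ^ m`, and `E < exp R` makes it exponentially small
(`exists_exponent`). -/

/-- The expectation of an `ℝ≥0∞`-valued function. -/
def expect {α : Type} (p : PMF α) (f : α → ℝ≥0∞) : ℝ≥0∞ := ∑' a, p a * f a

/-! ### Expectations of nonnegative functions under a discrete law. -/

section Expect

variable {α β : Type}

lemma expect_pure (a : α) (f : α → ℝ≥0∞) : expect (PMF.pure a) f = f a := by
  unfold expect
  rw [tsum_eq_single a]
  · simp
  · intro b hb
    simp [PMF.pure_apply, hb]

lemma expect_bind (p : PMF α) (q : α → PMF β) (f : β → ℝ≥0∞) :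
    expect (p.bind q) f = expect p fun a => expect (q a) f := by
  unfold expect
  simp_rw [PMF.bind_apply, ← ENNReal.tsum_mul_right, ← ENNReal.tsum_mul_left]
  rw [ENNReal.tsum_comm]
  simp_rw [mul_assoc]

lemma expect_map (p : PMF α) (g : α → β) (f : β → ℝ≥0∞) :
    expect (p.map g) f = expect p fun a => f (g a) := by
  unfold PMF.map
  rw [expect_bind]
  simp_rw [Function.comp, expect_pure]

lemma expect_mono (p : PMF α) {f g : α → ℝ≥0∞} (h : ∀ a ∈ p.support, f a ≤ g a) :
    expect p f ≤ expect p g := by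
  refine ENNReal.tsum_le_tsum fun a => ?_
  by_cases ha : p a = 0
  · simp [ha]
  · exact mul_le_mul_right (h a ha) _

lemma expect_add (p : PMF α) (f g : α → ℝ≥0∞) :
    expect p (fun a => f a + g a) = expect p f + expect p g := by
  unfold expect
  rw [← ENNReal.tsum_add]
  simp_rw [mul_add]

lemma expect_const (p : PMF α) (c : ℝ≥0∞) : expect p (fun _ => c) = c := by
  unfold expect
  rw [ENNReal.tsum_mul_right, p.tsum_coe, one_mul]

lemma expect_const_add (p : PMF α) (c : ℝ≥0∞) (f : α → ℝ≥0∞) :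
    expect p (fun a => c + f a) = c + expect p f := by
  rw [expect_add, expect_const]

lemma expect_const_mul (p : PMF α) (c : ℝ≥0∞) (f : α → ℝ≥0∞) :
    expect p (fun a => c * f a) = c * expect p f := by
  unfold expect
  simp_rw [← ENNReal.tsum_mul_left, mul_left_comm]

lemma expect_le_of_forall (p : PMF α) {f : α → ℝ≥0∞} {c : ℝ≥0∞}
    (h : ∀ a ∈ p.support, f a ≤ c) : expect p f ≤ c :=
  (expect_mono p h).trans_eq (expect_const p c)

lemma toOuterMeasure_eq_expect (p : PMF α) (s : Set α) :
    p.toOuterMeasure s = expect p (s.indicator 1) := by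
  rw [PMF.toOuterMeasure_apply]
  refine tsum_congr fun a => ?_
  by_cases h : a ∈ s <;> simp [h]

end Expect

lemma uniformOfFinset_map_apply {α β : Type} [DecidableEq β] {s : Finset α} (hs : s.Nonempty)
    (f : α → β) (b : β) :
    (PMF.uniformOfFinset s hs).map f b =
      (s.card : ℝ≥0∞)⁻¹ * ∑ a ∈ s, if b = f a then 1 else 0 := by
  classical
  rw [PMF.map_apply, tsum_eq_sum (s := s), Finset.mul_sum]
  · refine Finset.sum_congr rfl fun a ha => ?_
    rw [PMF.uniformOfFinset_apply_of_mem hs ha]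
    split_ifs <;> simp
  · intro a ha
    rw [PMF.uniformOfFinset_apply_of_notMem hs ha]
    simp

/-! ### Product laws. -/

section ProductLaw

variable {ι : Type} [Fintype ι] [DecidableEq ι] {α : ι → Type} [∀ i, Fintype (α i)]

lemma productLaw_apply (μ : (i : ι) → PMF (α i)) (x : (i : ι) → α i) :
    productLaw μ x = ∏ i, μ i (x i) := rfl

lemma productLaw_pure (x : (i : ι) → α i) :
    productLaw (fun i => PMF.pure (x i)) = PMF.pure x := by
  ext y
  rw [productLaw_apply, PMF.pure_apply]
  by_cases h : y = x
  · subst h; simp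
  · obtain ⟨i, hi⟩ := Function.ne_iff.1 h
    rw [if_neg h]
    exact Finset.prod_eq_zero (Finset.mem_univ i) (by simp [PMF.pure_apply, hi])

/-- A product law may be drawn by first drawing one of the coordinates. -/
lemma productLaw_eq_bind (μ : (i : ι) → PMF (α i)) (i : ι) :
    productLaw μ = (μ i).bind fun v => productLaw (Function.update μ i (PMF.pure v)) := by
  classical
  ext x
  rw [PMF.bind_apply, tsum_fintype, Finset.sum_eq_single (x i)]
  · rw [productLaw_apply, productLaw_apply, Fintype.prod_eq_mul_prod_compl i,
      Fintype.prod_eq_mul_prod_compl i (fun j => Function.update μ i (PMF.pure (x i)) j (x j))]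
    rw [Function.update_self, PMF.pure_apply_self, one_mul]
    congr 1
    refine Finset.prod_congr rfl fun j hj => ?_
    rw [Function.update_of_ne (by simpa using hj)]
  · intro v _ hv
    rw [productLaw_apply, Finset.prod_eq_zero (Finset.mem_univ i), mul_zero]
    rw [Function.update_self]
    simp [PMF.pure_apply, Ne.symm hv]
  · simp

end ProductLaw

/-! ### Timed computations: laws of results and worst-case step counts. -/

namespace Timed

variable {α β : Type}

lemma run_bind (x : Timed α) (f : α → Timed β) :
    (x >>= f).run = x.run.bind fun r => (f r.1).run.map fun s => (s.1, r.2 + s.2) := rfl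

lemma run_pure (a : α) : (pure a : Timed α).run = PMF.pure (a, 0) := rfl

@[simp] lemma law_pure (a : α) : (pure a : Timed α).law = PMF.pure a :=
  PMF.pure_map _ _

@[simp] lemma law_op (a : α) : (op a).law = PMF.pure a :=
  PMF.pure_map _ _

@[simp] lemma law_draw (μ : PMF α) : (draw μ).law = μ := by
  unfold law draw run
  rw [PMF.map_comp]
  exact PMF.map_id μ

@[simp] lemma law_bind (x : Timed α) (f : α → Timed β) :
    (x >>= f).law = x.law.bind fun a => (f a).law := by
  unfold law
  rw [run_bind, PMF.map_bind, PMF.bind_map]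
  congr 1
  ext1 r
  rw [PMF.map_comp]
  rfl

/-- Every outcome satisfies `p` and is reached after at most `K` steps. -/
def Sat (x : Timed α) (p : α → Prop) (K : ℕ) : Prop :=
  ∀ r ∈ x.run.support, p r.1 ∧ r.2 ≤ K

lemma Sat.pure {a : α} {p : α → Prop} (h : p a) (K : ℕ) : (pure a : Timed α).Sat p K := by
  intro r hr
  rw [run_pure, PMF.support_pure, Set.mem_singleton_iff] at hr
  subst hr
  exact ⟨h, Nat.zero_le _⟩

lemma Sat.op {a : α} {p : α → Prop} (h : p a) : (op a).Sat p 1 := by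
  intro r hr
  have hr' : r ∈ (PMF.pure (a, 1)).support := hr
  rw [PMF.support_pure, Set.mem_singleton_iff] at hr'
  subst hr'
  exact ⟨h, le_rfl⟩

lemma Sat.draw (μ : PMF α) : (draw μ).Sat (fun _ => True) 1 := by
  intro r hr
  have hr' : r ∈ (PMF.map (fun a => (a, 1)) μ).support := hr
  rw [PMF.mem_support_map_iff] at hr'
  obtain ⟨a, -, rfl⟩ := hr'
  exact ⟨trivial, le_rfl⟩

lemma Sat.bind {x : Timed α} {f : α → Timed β} {p : α → Prop} {q : β → Prop} {K L : ℕ}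
    (hx : x.Sat p K) (hf : ∀ a, p a → (f a).Sat q L) : (x >>= f).Sat q (K + L) := by
  intro r hr
  rw [run_bind, PMF.mem_support_bind_iff] at hr
  obtain ⟨s, hs, hr⟩ := hr
  rw [PMF.mem_support_map_iff] at hr
  obtain ⟨u, hu, rfl⟩ := hr
  have h1 := hx s hs
  have h2 := hf s.1 h1.1 u hu
  exact ⟨h2.1, Nat.add_le_add h1.2 h2.2⟩

lemma Sat.mono {x : Timed α} {p q : α → Prop} {K L : ℕ} (h : x.Sat p K)
    (hpq : ∀ a, p a → q a) (hKL : K ≤ L) : x.Sat q L :=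
  fun r hr => ⟨hpq _ (h r hr).1, (h r hr).2.trans hKL⟩

lemma Sat.op_bind {a : α} {f : α → Timed β} {q : β → Prop} {K : ℕ} (h : (f a).Sat q K) :
    (Timed.op a >>= f).Sat q (1 + K) :=
  Sat.bind (p := fun b => b = a) (Sat.op rfl) fun _ hb => hb ▸ h

lemma Sat.draw_bind {μ : PMF α} {f : α → Timed β} {q : β → Prop} {K : ℕ}
    (h : ∀ a, (f a).Sat q K) : (Timed.draw μ >>= f).Sat q (1 + K) :=
  Sat.bind (Sat.draw μ) fun b _ => h b

end Timed

/-! ### Law and cost of the subroutines of the program. -/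

section Program

variable {n m : ℕ} {A : AssignmentPacking n m}

lemma resample_empty (z : A.FractionalAssignment) (X : A.Config) :
    resample z X ∅ = PMF.pure X := by
  simp [resample, productLaw_pure]

/-- Conditioning on one coordinate turns the simultaneous redraw into the sequential one that the
program performs. -/
lemma resample_insert (z : A.FractionalAssignment) (X : A.Config) {i : Fin n}
    {S : Finset (Fin n)} (hi : i ∉ S) :
    resample z X (insert i S) = (z.law i).bind fun v => resample z (Function.update X i v) S := by
  unfold resample
  rw [productLaw_eq_bind _ i]
  simp only [Finset.mem_insert_self, if_true]
  congr 1
  ext1 v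
  congr 1
  ext1 j
  by_cases h : j = i
  · subst h
    simp [hi]
  · simp [h]

lemma resample_singleton (z : A.FractionalAssignment) (X : A.Config) (i : Fin n) :
    resample z X {i} = (z.law i).map fun v => Function.update X i v := by
  rw [← insert_empty_eq, resample_insert z X (Finset.notMem_empty i)]
  simp_rw [resample_empty]
  rfl

lemma resample_univ (z : A.FractionalAssignment) (X : A.Config) :
    resample z X Finset.univ = initialLaw z := by
  simp [resample, initialLaw]

lemma drawList_law (z : A.FractionalAssignment) {l : List (Fin n)} (hl : l.Nodup)
    (X : A.Config) : (drawList z l X).law = resample z X l.toFinset := by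
  induction l generalizing X with
  | nil => simp [drawList, resample_empty]
  | cons i l ih =>
    rw [List.nodup_cons] at hl
    rw [List.toFinset_cons, resample_insert z X (by simpa using hl.1)]
    simp [drawList, ih hl.2]

lemma drawList_finRange_law (z : A.FractionalAssignment) (X : A.Config) :
    (drawList z (List.finRange n) X).law = initialLaw z := by
  rw [drawList_law z (List.nodup_finRange n), List.toFinset_finRange, resample_univ]

lemma drawList_sat (z : A.FractionalAssignment) (l : List (Fin n)) (X : A.Config) :
    (drawList z l X).Sat (fun _ => True) (2 * l.length + 1) := by
  induction l generalizing X with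
  | nil => exact Timed.Sat.op trivial
  | cons i l ih =>
    refine Timed.Sat.mono (K := 1 + (1 + (2 * l.length + 1))) ?_ (fun _ h => h)
      (by rw [List.length_cons]; omega)
    exact Timed.Sat.draw_bind fun v => Timed.Sat.op_bind (ih _)

open Classical in
/-- The elements `(i, X_i)`, `i ∈ l`, that have coefficient 1 in row `k`. -/
def presentElems (X : A.Config) (k : Fin m) (l : List (Fin n)) : List A.Elem :=
  (l.filter fun i => A.coeff k i (X i) = 1).map fun i => ⟨i, X i⟩

lemma scanRow_law (X : A.Config) (k : Fin m) (l : List (Fin n)) :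
    (scanRow A X k l).law =
      PMF.pure (presentElems X k l, (presentElems X k l).length) := by
  induction l with
  | nil => simp [scanRow, presentElems]
  | cons i l ih =>
    by_cases h : A.coeff k i (X i) = 1
    · simp [scanRow, ih, h, presentElems]
    · simp [scanRow, ih, h, presentElems]

lemma scanRow_sat (X : A.Config) (k : Fin m) (l : List (Fin n)) :
    (scanRow A X k l).Sat (fun r => r.1.length ≤ l.length) (5 * l.length + 1) := by
  induction l with
  | nil => exact Timed.Sat.op le_rfl
  | cons i l ih =>
    unfold scanRow
    refine (Timed.Sat.bind (L := 5) ih fun r hr => ?_).mono (fun _ h => h)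
      (by rw [List.length_cons]; omega)
    refine Timed.Sat.op_bind (K := 4) (Timed.Sat.op_bind (K := 3) (Timed.Sat.op_bind (K := 2) ?_))
    split_ifs
    · refine Timed.Sat.op_bind (K := 1) (Timed.Sat.op_bind (K := 0) (Timed.Sat.pure ?_ 0))
      simpa using hr
    · exact (Timed.Sat.pure (p := fun u => u = r) rfl 2).mono
        (fun u hu => hu ▸ hr.trans (Nat.le_succ _)) le_rfl

lemma findViolated_law_none {T : Fin m → ℕ} {X : A.Config} {l : List (Fin m)}
    (h : ∀ k ∈ l, (presentElems X k (List.finRange n)).length ≤ T k) :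
    (findViolated A T X l).law = PMF.pure none := by
  induction l with
  | nil => simp [findViolated]
  | cons k l ih =>
    rw [List.forall_mem_cons] at h
    simp [findViolated, scanRow_law, ih h.2, not_lt.2 h.1]

/-- Which violated row is found is left open: the PRA may select any, so only a deterministic answer
that is correct matters. -/
lemma findViolated_law_some {T : Fin m → ℕ} {X : A.Config} {l : List (Fin m)}
    (h : ∃ k ∈ l, T k < (presentElems X k (List.finRange n)).length) :
    ∃ k, T k < (presentElems X k (List.finRange n)).length ∧
      (findViolated A T X l).law = PMF.pure (some (presentElems X k (List.finRange n))) := by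
  induction l with
  | nil => simp at h
  | cons k l ih =>
    by_cases hk : T k < (presentElems X k (List.finRange n)).length
    · exact ⟨k, hk, by simp [findViolated, scanRow_law, hk]⟩
    · obtain ⟨k', hk', hT⟩ := h
      have hl : k' ∈ l := by
        rcases List.mem_cons.1 hk' with rfl | h
        · exact absurd hT hk
        · exact h
      obtain ⟨k'', h1, h2⟩ := ih ⟨k', hl, hT⟩
      exact ⟨k'', h1, by simp [findViolated, scanRow_law, hk, h2]⟩

/-- The length bound is carried along because the later costs of the pass, sampling and redrawing,
are linear in this length. -/
lemma findViolated_sat (T : Fin m → ℕ) (X : A.Config) (l : List (Fin m)) :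
    (findViolated A T X l).Sat (fun o => ∀ B, o = some B → B.length ≤ n)
      ((5 * n + 4) * l.length + 1) := by
  induction l with
  | nil => exact Timed.Sat.op (by simp)
  | cons k l ih =>
    unfold findViolated
    refine (Timed.Sat.bind (L := 3 + ((5 * n + 4) * l.length + 1)) (scanRow_sat X k _)
      fun r hr => ?_).mono (fun _ h => h)
      (by rw [List.length_cons, List.length_finRange, mul_add]; omega)
    rw [List.length_finRange] at hr
    refine Timed.Sat.mono (K := 1 + (1 + ((5 * n + 4) * l.length + 1))) ?_ (fun _ h => h)
      (by omega)
    refine Timed.Sat.op_bind (Timed.Sat.op_bind ?_)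
    split_ifs
    · exact (Timed.Sat.op fun B hB => by rwa [← Option.some.inj hB]).mono (fun _ h => h) (by omega)
    · exact ih

/-- Describes the rest of the sampling once the single wanted member has been taken: no draw `u` is
below 0. -/
lemma chooseSublist_zero_law {α : Type} (l : List α) :
    (chooseSublist l 0).law = PMF.pure [] := by
  induction l with
  | nil => simp [chooseSublist]
  | cons x l ih => simp [chooseSublist, ih]

/-- Sequential sampling of a single member produces the uniform distribution. -/
lemma chooseSublist_one_law {α : Type} [DecidableEq α] {l : List α} (hl : l.Nodup)
    (h : l.toFinset.Nonempty) :
    (chooseSublist l 1).law = (PMF.uniformOfFinset l.toFinset h).map fun x => [x] := by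
  induction l with
  | nil => simp at h
  | cons x l ih =>
    rw [List.nodup_cons] at hl
    have hx : x ∉ l.toFinset := by simpa using hl.1
    have htake : ∀ u : Fin (l.length + 1), ((u : ℕ) < 1) ↔ u = 0 := fun u => by
      rw [Nat.lt_one_iff, Fin.ext_iff]; rfl
    have hlaw : (chooseSublist (x :: l) 1).law =
        (PMF.uniformOfFintype (Fin (l.length + 1))).bind fun u =>
          if u = 0 then PMF.pure [x] else (chooseSublist l 1).law := by
      simp only [chooseSublist, Timed.law_bind, Timed.law_op, Timed.law_draw, PMF.pure_bind,
        decide_eq_true_eq, htake]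
      congr 1
      ext1 u
      split_ifs
      · simp [chooseSublist_zero_law]
      · rfl
    rw [hlaw]
    ext Y
    rw [uniformOfFinset_map_apply, PMF.bind_apply, tsum_fintype, Fin.sum_univ_succ,
      List.toFinset_cons, Finset.sum_insert hx, Finset.card_insert_of_notMem hx, mul_add]
    rw [List.toFinset_card_of_nodup hl.2]
    simp only [PMF.uniformOfFintype_apply, Fintype.card_fin, if_true, Fin.succ_ne_zero, if_false,
      PMF.pure_apply, Finset.sum_const, Finset.card_univ]
    refine congrArg₂ (· + ·) (by congr) ?_
    -- The head is refused for `l.length` of the `l.length + 1` values of `u`, and this factor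
    -- cancels the `1 / l.length` of the tail. An empty tail carries no uniform law and is treated
    -- apart.
    rcases l.toFinset.eq_empty_or_nonempty with h0 | h0
    · rw [List.toFinset_eq_empty_iff] at h0
      subst h0
      simp
    · rw [ih hl.2 h0, uniformOfFinset_map_apply, List.toFinset_card_of_nodup hl.2, nsmul_eq_mul,
        mul_left_comm, ← mul_assoc (l.length : ℝ≥0∞), ENNReal.mul_inv_cancel, one_mul]
      · have : l ≠ [] := by rintro rfl; simp at h0
        simpa using this
      · exact ENNReal.natCast_ne_top _

lemma chooseSublist_sat {α : Type} (l : List α) (d : ℕ) :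
    (chooseSublist l d).Sat (fun Y => Y.length ≤ l.length) (5 * l.length + 1) := by
  induction l generalizing d with
  | nil => exact Timed.Sat.op le_rfl
  | cons x l ih =>
    unfold chooseSublist
    refine Timed.Sat.mono (K := 1 + (1 + (1 + (5 * l.length + 3)))) ?_ (fun _ h => h)
      (by rw [List.length_cons]; omega)
    refine Timed.Sat.op_bind (Timed.Sat.draw_bind fun u => Timed.Sat.op_bind ?_)
    split_ifs
    · refine Timed.Sat.mono (K := 1 + ((5 * l.length + 1) + 1)) ?_ (fun _ h => h) (by omega)
      refine Timed.Sat.op_bind (Timed.Sat.bind (ih _) fun Y hY => Timed.Sat.op ?_)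
      simpa using hY
    · exact (ih _).mono (fun _ h => h.trans (by simp)) (by omega)

lemma resampleList_sat (z : A.FractionalAssignment) (l : List A.Elem) (X : A.Config) :
    (resampleList z l X).Sat (fun _ => True) (3 * l.length + 1) := by
  induction l generalizing X with
  | nil => exact Timed.Sat.op trivial
  | cons x l ih =>
    refine Timed.Sat.mono (K := 1 + (1 + (1 + (3 * l.length + 1)))) ?_ (fun _ h => h)
      (by rw [List.length_cons]; omega)
    exact Timed.Sat.op_bind (Timed.Sat.draw_bind fun v => Timed.Sat.op_bind (ih _))

lemma resampleList_singleton_law (z : A.FractionalAssignment) (x : A.Elem) (X : A.Config) :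
    (resampleList z [x] X).law = resample z X {x.1} := by
  rw [resample_singleton]
  simp [resampleList]
  rfl

/-- A bound for the number of steps of one pass of the main loop. -/
def passCost (n m : ℕ) : ℕ := (5 * n + 4) * m + 8 * n + 3

/-- The search costs at most `(5 * n + 4) * m + 1` steps, the sampling `5 * n + 1` and the redrawing
`3 * n + 1`. -/
lemma praPass_sat (z : A.FractionalAssignment) (T : Fin m → ℕ) (d : ℕ) (X : A.Config) :
    (praPass z T d X).Sat (fun _ => True) (passCost n m) := by
  unfold praPass
  refine (Timed.Sat.bind (L := 8 * n + 2) (findViolated_sat T X _) fun o ho => ?_).mono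
    (fun _ h => h) (by rw [List.length_finRange, passCost]; omega)
  match o, ho with
  | none, _ => exact Timed.Sat.pure trivial _
  | some B, ho =>
    have hB := ho B rfl
    refine (Timed.Sat.bind (L := 3 * n + 1) (chooseSublist_sat B d) fun Y hY => ?_).mono
      (fun _ h => h) (by omega)
    refine Timed.Sat.mono (K := (3 * Y.length + 1) + 0) ?_ (fun _ h => h) (by omega)
    exact Timed.Sat.bind (resampleList_sat z Y X) fun X' _ => Timed.Sat.pure trivial 0

end Program

/-! ### The hitting-set of singletons. -/

section Sampling

variable {n m : ℕ} {A : AssignmentPacking n m}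

/-- The hitting-set that gives every singleton the weight `1 / (t + 1)`. -/
def singletonHittingSet (A : AssignmentPacking n m) (t : ℕ) (Y : Finset A.Elem) : ℝ≥0 :=
  if Y.card = 1 then ((t : ℝ≥0) + 1)⁻¹ else 0

lemma sum_powerset_singletonHittingSet (t : ℕ) (B : Finset A.Elem) :
    ∑ Y ∈ B.powerset, singletonHittingSet A t Y = B.card * ((t : ℝ≥0) + 1)⁻¹ := by
  unfold singletonHittingSet
  rw [← Finset.sum_filter, ← Finset.powersetCard_eq_filter, Finset.sum_const,
    Finset.card_powersetCard, Nat.choose_one_right, nsmul_eq_mul]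

/-- The common weight cancels in the normalization, so the value `1 / (t + 1)` has no influence on
the selection; it matters only for being a hitting-set. -/
lemma selectSubset_singletonHittingSet (t : ℕ) {B : Finset A.Elem} (hB : B.Nonempty) :
    selectSubset (singletonHittingSet A t) B =
      (PMF.uniformOfFinset B hB).map fun x => {x} := by
  have hc : (B.card : ℝ≥0) ≠ 0 := by simpa using hB.ne_empty
  have ht : ((t : ℝ≥0) + 1)⁻¹ ≠ 0 := by positivity
  have h0 : ∑ Y ∈ B.powerset, singletonHittingSet A t Y ≠ 0 := by
    rw [sum_powerset_singletonHittingSet]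
    exact mul_ne_zero hc ht
  ext Y
  rw [uniformOfFinset_map_apply, selectSubset, dif_neg h0, PMF.ofFinset_apply,
    sum_powerset_singletonHittingSet]
  by_cases hY : ∃ x ∈ B, Y = {x}
  · obtain ⟨x, hx, rfl⟩ := hY
    rw [if_pos (by simpa using hx), singletonHittingSet, if_pos (Finset.card_singleton x),
      Finset.sum_eq_single x (fun y _ hy => if_neg (by simpa using hy.symm)) (fun h => absurd hx h),
      if_pos rfl, mul_one, div_mul_cancel_right₀ ht, ENNReal.coe_inv hc, ENNReal.coe_natCast]
  · push Not at hY
    rw [Finset.sum_eq_zero (fun x hx => if_neg (hY x hx)), mul_zero]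
    split_ifs with hs
    · have : Y.card ≠ 1 := fun h => by
        obtain ⟨x, rfl⟩ := Finset.card_eq_one.1 h
        exact hY x (by simpa using hs) rfl
      simp [singletonHittingSet, this]
    · rfl

lemma praMove_singletonHittingSet (z : A.FractionalAssignment) (t : ℕ) {B : Finset A.Elem}
    (hB : B.Nonempty) (X : A.Config) :
    praMove z (singletonHittingSet A t) B X = (PMF.uniformOfFinset B hB).bind fun x =>
      (z.law x.1).map fun v => ({x}, Function.update X x.1 v) := by
  unfold praMove
  rw [selectSubset_singletonHittingSet t hB, PMF.bind_map]
  congr 1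
  ext1 x
  simp only [Function.comp, Finset.image_singleton, resample_singleton, PMF.map_comp]
  rfl

end Sampling

/-! ### Balls in bins: bad-events and the drift of the excess. -/

section BallsInBins

variable {n m : ℕ}

/-- The assignment-packing problem in which variable `i` is a ball, its value is the bin that it
is thrown into, and constraint `k` bounds the number of balls in bin `k`. -/
abbrev ballsInBins (n m : ℕ) : AssignmentPacking n m where
  numVals _ := m
  coeff k _ j := if j = k then 1 else 0
  coeff_mem k i j := by split_ifs <;> simp

/-- All bins are equally likely. -/
def uniformAssignment (n : ℕ) {m : ℕ} (hm : m ≠ 0) : (ballsInBins n m).FractionalAssignment where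
  val _ _ := 1 / m
  nonneg _ _ := by positivity
  sum_eq_one i := by
    change ∑ _ : Fin m, (1 / m : ℝ) = 1
    rw [Finset.sum_const, Finset.card_univ, Fintype.card_fin, nsmul_eq_mul, mul_one_div_cancel]
    exact_mod_cast hm

/-- The number of balls in bin `k`. -/
def binLoad (X : Fin n → Fin m) (k : Fin m) : ℕ := (Finset.univ.filter fun i => X i = k).card

lemma load_ballsInBins (X : (ballsInBins n m).Config) (k : Fin m) :
    (ballsInBins n m).load k X = binLoad X k := by
  change ∑ i, (if X i = k then (1 : ℝ) else 0) = _
  rw [Finset.sum_boole]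
  rfl

lemma sum_binLoad (X : Fin n → Fin m) : ∑ k, binLoad X k = n := by
  unfold binLoad
  rw [← Finset.card_eq_sum_card_fiberwise (fun _ _ => Finset.mem_coe.2 (Finset.mem_univ _)),
    Finset.card_univ, Fintype.card_fin]

lemma presentElems_ballsInBins (X : (ballsInBins n m).Config) (k : Fin m) :
    presentElems X k (List.finRange n) =
      ((List.finRange n).filter fun i => X i = k).map fun i => ⟨i, X i⟩ := by
  unfold presentElems
  congr 1
  refine List.filter_congr fun i _ => ?_
  have : (ballsInBins n m).coeff k i (X i) = 1 ↔ X i = k := by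
    change (if X i = k then (1 : ℝ) else 0) = 1 ↔ _
    split_ifs with h <;> simp [h]
  simp only [this]

lemma presentElems_nodup (X : (ballsInBins n m).Config) (k : Fin m) :
    (presentElems X k (List.finRange n)).Nodup := by
  rw [presentElems_ballsInBins]
  exact ((List.nodup_finRange n).filter _).map fun i j h => congrArg Sigma.fst h

lemma length_presentElems (X : (ballsInBins n m).Config) (k : Fin m) :
    (presentElems X k (List.finRange n)).length = binLoad X k := by
  rw [presentElems_ballsInBins, List.length_map,
    ← List.toFinset_card_of_nodup ((List.nodup_finRange n).filter _)]
  unfold binLoad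
  congr 1
  ext i
  simp

lemma mem_presentElems (X : (ballsInBins n m).Config) (k : Fin m)
    (x : (ballsInBins n m).Elem) :
    x ∈ presentElems X k (List.finRange n) ↔ X x.1 = k ∧ X x.1 = x.2 := by
  rw [presentElems_ballsInBins]
  simp only [List.mem_map, List.mem_filter, List.mem_finRange, true_and, decide_eq_true_eq]
  constructor
  · rintro ⟨i, h, rfl⟩
    exact ⟨h, rfl⟩
  · rintro ⟨h1, h2⟩
    exact ⟨x.1, h1, Sigma.ext rfl (heq_of_eq h2)⟩

/-- For a right-hand side between the integers `t` and `t + 1`, the bad-events of bin `k` are the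
sets of more than `t` balls in it. -/
lemma mem_badEvents_iff {b : ℝ} {t : ℕ} (ht : ∀ c : ℕ, b < c ↔ t < c) (k : Fin m)
    (B : Finset (ballsInBins n m).Elem) :
    B ∈ badEvents (ballsInBins n m) (fun _ => b) k ↔
      (∀ x ∈ B, ∀ y ∈ B, x.1 = y.1 → x = y) ∧ (∀ x ∈ B, x.2 = k) ∧ t < B.card := by
  have hpos : ∀ x : (ballsInBins n m).Elem,
      0 < (ballsInBins n m).coeff k x.1 x.2 ↔ x.2 = k := fun x => by
    change 0 < (if x.2 = k then (1 : ℝ) else 0) ↔ _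
    split_ifs with h <;> simp [h]
  unfold badEvents
  rw [Set.mem_ofPred_eq]
  simp only [hpos]
  refine and_congr_right fun _ => and_congr_right fun h => ?_
  have : ∑ x ∈ B, (ballsInBins n m).coeff k x.1 x.2 = (B.card : ℝ) := by
    rw [Finset.sum_congr rfl (g := fun _ => (1 : ℝ)) fun x hx => ?_]
    · simp
    · change (if x.2 = k then (1 : ℝ) else 0) = 1
      exact if_pos (h x hx)
  rw [this, ht]

lemma card_le_binLoad {X : (ballsInBins n m).Config} {B : Finset (ballsInBins n m).Elem}
    {k : Fin m} (h2 : ∀ x ∈ B, x.2 = k)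
    (h3 : Occurs B X) : B.card ≤ binLoad X k := by
  rw [← length_presentElems, ← List.toFinset_card_of_nodup (presentElems_nodup X k)]
  refine Finset.card_le_card fun x hx => ?_
  rw [List.mem_toFinset, mem_presentElems]
  exact ⟨(h3 x hx).trans (h2 x hx), h3 x hx⟩

lemma presentElems_mem_badEvents {b : ℝ} {t : ℕ} (ht : ∀ c : ℕ, b < c ↔ t < c) {k : Fin m}
    {X : (ballsInBins n m).Config} (h : t < binLoad X k) :
    (presentElems X k (List.finRange n)).toFinset ∈
        badEvents (ballsInBins n m) (fun _ => b) k ∧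
      Occurs (presentElems X k (List.finRange n)).toFinset X := by
  have hmem : ∀ x ∈ (presentElems X k (List.finRange n)).toFinset, X x.1 = k ∧ X x.1 = x.2 :=
    fun x hx => (mem_presentElems X k x).1 (List.mem_toFinset.1 hx)
  refine ⟨(mem_badEvents_iff ht k _).2 ⟨fun x hx y hy hxy => ?_, fun x hx => ?_, ?_⟩,
    fun x hx => (hmem x hx).2⟩
  · refine Sigma.ext hxy (heq_of_eq ?_)
    exact ((hmem x hx).2.symm.trans ((hmem x hx).1.trans (hmem y hy).1.symm)).trans (hmem y hy).2
  · exact (hmem x hx).2.symm.trans (hmem x hx).1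
  · rwa [List.toFinset_card_of_nodup (presentElems_nodup X k), length_presentElems]

/-- The balls of an overfull bin form a true bad-event, and conversely all the balls of a true
bad-event lie in its bin. -/
lemma someBadEvent_iff {b : ℝ} {t : ℕ} (ht : ∀ c : ℕ, b < c ↔ t < c)
    (X : (ballsInBins n m).Config) :
    SomeBadEvent (A := ballsInBins n m) (fun _ => b) X ↔ ∃ k, t < binLoad X k := by
  constructor
  · rintro ⟨k, B, hB, hX⟩
    rw [mem_badEvents_iff ht] at hB
    exact ⟨k, hB.2.2.trans_le (card_le_binLoad hB.2.1 hX)⟩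
  · rintro ⟨k, hk⟩
    exact ⟨k, _, presentElems_mem_badEvents ht hk⟩

/-- A bad-event has at least `t + 1` elements, each contributing a singleton of weight `1 / (t +
1)`. -/
lemma isFractionalHittingSet_singleton {b : ℝ} {t : ℕ} (ht : ∀ c : ℕ, b < c ↔ t < c)
    (k : Fin m) :
    IsFractionalHittingSet (singletonHittingSet (ballsInBins n m) t)
      (badEvents (ballsInBins n m) (fun _ => b) k) := by
  refine ⟨fun Y => ?_, fun B hB => ?_⟩
  · unfold singletonHittingSet
    split_ifs
    · exact inv_le_one_of_one_le₀ (by simp)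
    · exact zero_le_one
  · rw [mem_badEvents_iff ht] at hB
    rw [sum_powerset_singletonHittingSet, ← div_eq_mul_inv, one_le_div (by positivity)]
    exact_mod_cast hB.2.2

/-- The selected bad-event consists of all the balls of the bin that the scan finds. Sequential
sampling with `d = 1` and the singleton hitting-set both pick a uniform member of it. -/
lemma implementsPRA_ballsInBins (z : (ballsInBins n m).FractionalAssignment) {b : ℝ} {t : ℕ}
    (ht : ∀ c : ℕ, b < c ↔ t < c) :
    ImplementsPRA z (fun _ => b) (fun _ => singletonHittingSet (ballsInBins n m) t)
      (fun _ => t) 1 := by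
  refine ⟨drawList_finRange_law z, fun X => ⟨fun h => ?_, fun h => ?_⟩⟩
  · rw [someBadEvent_iff ht] at h
    push Not at h
    unfold praPass
    rw [Timed.law_bind, findViolated_law_none fun k _ => (length_presentElems X k).trans_le (h k)]
    simp
  · obtain ⟨k, hk⟩ := (someBadEvent_iff ht X).1 h
    obtain ⟨k, hk, hlaw⟩ := findViolated_law_some (T := fun _ => t) (X := X)
      (l := List.finRange m) ⟨k, List.mem_finRange k, by rwa [length_presentElems]⟩
    have hbad := presentElems_mem_badEvents ht (k := k) (X := X) (by rwa [← length_presentElems])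
    have hne : (presentElems X k (List.finRange n)).toFinset.Nonempty := by
      rw [List.toFinset_nonempty_iff, ← List.length_pos_iff]
      exact (Nat.zero_le _).trans_lt hk
    refine ⟨k, _, hbad.1, hbad.2, ?_⟩
    unfold praPass
    rw [Timed.law_bind, hlaw, PMF.pure_bind, praMove_singletonHittingSet z t hne, PMF.map_bind]
    simp only [Timed.law_bind, chooseSublist_one_law (presentElems_nodup X k) hne, PMF.bind_map,
      Timed.law_pure, PMF.map_comp]
    congr 1
    ext1 x
    simp only [Function.comp, resampleList_singleton_law, resample_singleton, PMF.bind_map]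
    rfl

/-- The total number of balls in excess of `t` in their bin, multiplied by `t`. -/
def excess (t : ℕ) (X : Fin n → Fin m) : ℕ := t * ∑ k, (binLoad X k - t)

lemma excess_le (t : ℕ) (X : Fin n → Fin m) : excess t X ≤ t * n :=
  Nat.mul_le_mul_left t
    ((Finset.sum_le_sum fun _ _ => Nat.sub_le _ _).trans_eq (sum_binLoad X))

lemma binLoad_update_add (X : Fin n → Fin m) (i : Fin n) (v k : Fin m) :
    binLoad (Function.update X i v) k + (if X i = k then 1 else 0) =
      binLoad X k + (if v = k then 1 else 0) := by
  have key : ∀ Y : Fin n → Fin m, binLoad Y k =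
      (if Y i = k then 1 else 0) + ∑ j ∈ Finset.univ.erase i, if Y j = k then 1 else 0 := by
    intro Y
    unfold binLoad
    rw [Finset.card_filter, ← Finset.add_sum_erase _ _ (Finset.mem_univ i)]
  rw [key X, key (Function.update X i v), Function.update_self]
  have : ∑ j ∈ Finset.univ.erase i, (if Function.update X i v j = k then 1 else 0) =
      ∑ j ∈ Finset.univ.erase i, if X j = k then 1 else 0 :=
    Finset.sum_congr rfl fun j hj => by rw [Function.update_of_ne (Finset.ne_of_mem_erase hj)]
  rw [this]
  ring

/-- Rethrowing a ball of an overfull bin. -/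
lemma sum_excess_update_le (t : ℕ) (X : Fin n → Fin m) (i : Fin n) (hi : t < binLoad X (X i))
    (v : Fin m) :
    ∑ k, (binLoad (Function.update X i v) k - t) + 1 ≤
      ∑ k, (binLoad X k - t) + if t ≤ binLoad X v then 1 else 0 := by
  -- Bin by bin: the source bin is above `t`, so losing a ball costs it a full unit of excess; the
  -- target gains a unit only if it already holds `t` balls. If the two coincide, the indicators
  -- balance.
  have h : ∀ k, (binLoad (Function.update X i v) k - t) + (if X i = k then 1 else 0) ≤
      (binLoad X k - t) + if v = k then (if t ≤ binLoad X v then 1 else 0) else 0 := by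
    intro k
    have h1 := binLoad_update_add X i v k
    by_cases hk : X i = k
    · subst hk
      split_ifs at h1 ⊢ <;> simp_all <;> omega
    · by_cases hv : v = k
      · subst hv
        split_ifs at h1 ⊢ <;> simp_all
        omega
      · simp_all
  have := Finset.sum_le_sum fun k (_ : k ∈ Finset.univ) => h k
  rw [Finset.sum_add_distrib, Finset.sum_add_distrib, Finset.sum_ite_eq, Finset.sum_ite_eq] at this
  simpa using this

/-- Rethrowing a ball of an overfull bin decreases the excess by at least 1 on average. -/
lemma sum_excess_update_add_le {t : ℕ} (hnm : n + m ≤ t * m) (X : Fin n → Fin m) (i : Fin n)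
    (hi : t < binLoad X (X i)) :
    ∑ v, excess t (Function.update X i v) + m ≤ m * excess t X := by
  have h1 := Finset.sum_le_sum fun v (_ : v ∈ Finset.univ) => sum_excess_update_le t X i hi v
  rw [Finset.sum_add_distrib, Finset.sum_add_distrib] at h1
  simp only [Finset.sum_const, Finset.card_univ, Fintype.card_fin, smul_eq_mul, mul_one] at h1
  -- Markov's inequality: each bin counted here holds at least `t` of the `n` balls.
  have h2 : t * ∑ v, (if t ≤ binLoad X v then 1 else 0) ≤ n := by
    rw [Finset.mul_sum]
    refine (Finset.sum_le_sum fun v _ => ?_).trans_eq (sum_binLoad X)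
    split_ifs with h
    · simpa using h
    · simp
  have h3 := Nat.mul_le_mul_left t h1
  unfold excess
  rw [← Finset.mul_sum]
  rw [mul_add, mul_add] at h3
  have h4 : m * (t * ∑ k, (binLoad X k - t)) = t * (m * ∑ k, (binLoad X k - t)) := by ring
  omega

lemma law_uniformAssignment (hm : m ≠ 0) (i : Fin n) (v : Fin m) :
    (uniformAssignment n hm).law i v = (m : ℝ≥0∞)⁻¹ := by
  change ENNReal.ofReal (1 / m) = _
  rw [one_div, ENNReal.ofReal_inv_of_pos (by positivity), ENNReal.ofReal_natCast]

lemma expect_excess_update (hm : m ≠ 0) {t : ℕ} (hnm : n + m ≤ t * m) (X : Fin n → Fin m)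
    (i : Fin n) (hi : t < binLoad X (X i)) :
    expect ((uniformAssignment n hm).law i)
      (fun v => (excess t (Function.update X i v) : ℝ≥0∞)) + 1 ≤ excess t X := by
  have hm' : (m : ℝ≥0∞) ≠ 0 := by exact_mod_cast hm
  have h : expect ((uniformAssignment n hm).law i)
      (fun v => (excess t (Function.update X i v) : ℝ≥0∞)) =
      (m : ℝ≥0∞)⁻¹ * (∑ v, excess t (Function.update X i v) : ℕ) := by
    unfold expect
    rw [tsum_fintype, Nat.cast_sum, Finset.mul_sum]
    exact Finset.sum_congr rfl fun v _ => congrArg (· * _) (law_uniformAssignment hm i v)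
  rw [h, ← ENNReal.inv_mul_cancel hm' (ENNReal.natCast_ne_top m), ← mul_add,
    ENNReal.inv_mul_le_iff hm' (ENNReal.natCast_ne_top m)]
  exact_mod_cast sum_excess_update_add_le hnm X i hi

/-- Every ball of a true bad-event lies in the same overfull bin, so the drift bound holds for each
choice of the ball and hence on average over the choices. -/
lemma expect_excess_praMove (hm : m ≠ 0) {b : ℝ} {t : ℕ} (ht : ∀ c : ℕ, b < c ↔ t < c)
    (hnm : n + m ≤ t * m) {k : Fin m} {B : Finset (ballsInBins n m).Elem}
    {X : (ballsInBins n m).Config} (hB : B ∈ badEvents (ballsInBins n m) (fun _ => b) k)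
    (hX : Occurs B X) :
    expect (praMove (uniformAssignment n hm) (singletonHittingSet (ballsInBins n m) t) B X)
      (fun r => (excess t r.2 : ℝ≥0∞)) + 1 ≤ excess t X := by
  rw [mem_badEvents_iff ht] at hB
  have hne : B.Nonempty := Finset.card_pos.1 ((Nat.zero_le t).trans_lt hB.2.2)
  have hload := hB.2.2.trans_le (card_le_binLoad hB.2.1 hX)
  rw [praMove_singletonHittingSet _ t hne, expect_bind]
  nth_rw 1 [← expect_const (PMF.uniformOfFinset B hne) 1]
  rw [← expect_add]
  refine expect_le_of_forall _ fun x hx => ?_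
  rw [PMF.mem_support_uniformOfFinset_iff] at hx
  rw [expect_map]
  exact expect_excess_update hm hnm X x.1 (by rwa [hX x hx, hB.2.1 x hx])

end BallsInBins

/-! ### From a potential to bounds on resamplings and running time. -/

section Potential

variable {n m : ℕ} {A : AssignmentPacking n m}

/-- `Ψ` decreases by at least 1 on average in every possible resampling of the PRA. -/
def IsPotential (z : A.FractionalAssignment) (b : Fin m → ℝ) (Q : Fin m → Finset A.Elem → ℝ≥0)
    (Ψ : A.Config → ℝ≥0∞) : Prop :=
  ∀ X k, ∀ B ∈ badEvents A b k, Occurs B X →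
    expect (praMove z (Q k) B X) (fun r => Ψ r.2) + 1 ≤ Ψ X

variable {z : A.FractionalAssignment} {b : Fin m → ℝ} {Q : Fin m → Finset A.Elem → ℝ≥0}
  {Ψ : A.Config → ℝ≥0∞}

/-- Holds state by state: a running state pays 1 out of its potential for its resampling, and a
halted one neither pays nor moves. Validity of the rule ensures that the resampled event is a true
bad-event. -/
lemma expect_praLaw_succ_add_le (hΨ : IsPotential z b Q Ψ) {σ : PRARule A} (hσ : σ.Valid b)
    (t : ℕ) :
    expect (praLaw z b Q σ (t + 1)) (fun s => Ψ s.2) +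
        (praLaw z b Q σ t).toOuterMeasure {s | SomeBadEvent b s.2} ≤
      expect (praLaw z b Q σ t) fun s => Ψ s.2 := by
  classical
  rw [toOuterMeasure_eq_expect, praLaw, expect_bind, ← expect_add]
  refine expect_mono _ fun s _ => ?_
  by_cases hs : SomeBadEvent b s.2
  · rw [if_pos hs, expect_map, Set.indicator_of_mem (by exact hs)]
    have h := hσ s.1 s.2 hs
    exact hΨ s.2 _ _ h.1 h.2
  · rw [if_neg hs, expect_pure, Set.indicator_of_notMem (by exact hs), add_zero]

/-- The drift inequality telescopes, so the initial potential pays for all resamplings. -/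
lemma praExpectedResamplings_le (hΨ : IsPotential z b Q Ψ) {σ : PRARule A} (hσ : σ.Valid b)
    {c : ℝ≥0∞} (hc : ∀ X, Ψ X ≤ c) : praExpectedResamplings z b Q σ ≤ c := by
  refine ENNReal.tsum_le_of_sum_range_le fun N => ?_
  refine le_trans ?_ (expect_le_of_forall (praLaw z b Q σ 0) fun s _ => hc s.2)
  have key : ∀ N, expect (praLaw z b Q σ N) (fun s => Ψ s.2) + ∑ t ∈ Finset.range N,
      (praLaw z b Q σ t).toOuterMeasure {s | SomeBadEvent b s.2} ≤
        expect (praLaw z b Q σ 0) fun s => Ψ s.2 := by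
    intro N
    induction N with
    | zero => simp
    | succ N ih =>
      rw [Finset.sum_range_succ, add_comm (∑ t ∈ _, _), ← add_assoc]
      exact (add_le_add_left (expect_praLaw_succ_add_le hΨ hσ N) _).trans ih
  exact le_add_self.trans (key N)

lemma Timed.expect_run_bind {α β : Type} (x : Timed α) (f : α → Timed β) (g : β × ℕ → ℝ≥0∞) :
    expect (x >>= f).run g =
      expect x.run fun r => expect (f r.1).run fun s => g (s.1, r.2 + s.2) := by
  rw [Timed.run_bind, expect_bind]
  simp_rw [expect_map]

lemma Timed.expect_law {α : Type} (x : Timed α) (g : α → ℝ≥0∞) :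
    expect x.law g = expect x.run fun r => g r.1 :=
  expect_map _ _ _

/-- The potential of a state of the program that makes passes of cost at most `K`. -/
def programPotential (Ψ : A.Config → ℝ≥0∞) (K : ℝ≥0∞) (s : A.Config × Bool) : ℝ≥0∞ :=
  if s.2 then 0 else K * (1 + Ψ s.1)

variable {T : Fin m → ℕ} {d : ℕ}

/-- The summand 1 in `1 + Ψ` pays for the last pass, which resamples nothing and only discovers that
no constraint is violated. -/
lemma expect_praPass_le (hΨ : IsPotential z b Q Ψ) (hI : ImplementsPRA z b Q T d)
    (X : A.Config) (K : ℝ≥0∞) :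
    K + expect (praPass z T d X).law (fun o => o.elim 0 fun X' => K * (1 + Ψ X')) ≤
      K * (1 + Ψ X) := by
  by_cases hX : SomeBadEvent b X
  · obtain ⟨k, B, hB, hBX, hlaw⟩ := (hI.2 X).2 hX
    rw [hlaw, expect_map]
    simp only [Option.elim_some]
    rw [expect_const_mul, expect_const_add, mul_add K 1 (Ψ X), mul_one, add_comm 1]
    gcongr
    exact hΨ X k B hB hBX
  · rw [(hI.2 X).1 hX, expect_pure]
    simp only [Option.elim_none, add_zero]
    exact le_mul_of_one_le_right' le_self_add

/-- Steps spent so far plus remaining potential form a supermartingale, as each pass is charged its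
worst-case cost. -/
lemma expect_praProgram_succ_le (hΨ : IsPotential z b Q Ψ) (hI : ImplementsPRA z b Q T d)
    (X₀ : A.Config) (t : ℕ) :
    expect (praProgram z T d X₀ (t + 1)).run
        (fun r => r.2 + programPotential Ψ (passCost n m) r.1) ≤
      expect (praProgram z T d X₀ t).run
        (fun r => r.2 + programPotential Ψ (passCost n m) r.1) := by
  rw [praProgram, Timed.expect_run_bind]
  refine expect_mono _ fun r _ => ?_
  obtain ⟨⟨X, halted⟩, c⟩ := r
  cases halted
  · simp only [Bool.false_eq_true, if_false, Timed.expect_run_bind]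
    refine le_trans ?_ (add_le_add_right (expect_praPass_le hΨ hI X (passCost n m)) (c : ℝ≥0∞))
    rw [Timed.expect_law, ← expect_const_add, ← expect_const_add]
    refine expect_mono _ fun s hs => ?_
    have hcost : (s.2 : ℝ≥0∞) ≤ passCost n m := by exact_mod_cast (praPass_sat z T d X s hs).2
    obtain ⟨o, e⟩ := s
    cases o with
    | none =>
      simp only [Timed.run_pure, expect_pure, programPotential]
      simpa using hcost
    | some X' =>
      simp only [Timed.run_pure, expect_pure, programPotential]
      simp only [add_zero, Nat.cast_add, Bool.false_eq_true, if_false, Option.elim_some, add_assoc]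
      gcongr
  · simp only [if_true, Timed.run_pure, expect_pure, add_zero]
    exact le_rfl

lemma praExpectedTime_le (hΨ : IsPotential z b Q Ψ) (hI : ImplementsPRA z b Q T d)
    (X₀ : A.Config) {c : ℝ≥0∞} (hc : ∀ X, Ψ X ≤ c) :
    praExpectedTime z T d X₀ ≤ (2 * n + 1 : ℕ) + passCost n m * (1 + c) := by
  refine iSup_le fun t => ?_
  have h0 : expect (praProgram z T d X₀ 0).run
      (fun r => r.2 + programPotential Ψ (passCost n m) r.1) ≤
        (2 * n + 1 : ℕ) + passCost n m * (1 + c) := by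
    refine expect_le_of_forall _ fun r hr => ?_
    have hsat : (praProgram z T d X₀ 0).Sat (fun s => s.2 = false) (2 * n + 1) := by
      have h := Timed.Sat.bind (drawList_sat z (List.finRange n) X₀)
        fun X _ => Timed.Sat.pure (a := (X, false)) (p := fun s => s.2 = false) rfl 0
      rwa [List.length_finRange] at h
    have h := hsat r hr
    unfold programPotential
    rw [h.1, if_neg Bool.false_ne_true]
    gcongr
    · exact_mod_cast h.2
    · exact hc _
  refine le_trans ?_ ((antitone_nat_of_succ_le
    (fun t => expect_praProgram_succ_le hΨ hI X₀ t) (Nat.zero_le t)).trans h0)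
  exact expect_mono _ fun r _ => le_self_add

end Potential

lemma isPotential_excess {n m : ℕ} (hm : m ≠ 0) {b : ℝ} {t : ℕ} (ht : ∀ c : ℕ, b < c ↔ t < c)
    (hnm : n + m ≤ t * m) :
    IsPotential (uniformAssignment n hm) (fun _ => b)
      (fun _ => singletonHittingSet (ballsInBins n m) t)
      (fun X : Fin n → Fin m => (excess t X : ℝ≥0∞)) :=
  fun _ _ _ hB hX => expect_excess_praMove hm ht hnm hB hX

/-! ### Counting estimates: polynomial running time, bounded bins, Stirling. -/

/-- An upper bound for the running time of the program, in terms of the size `s = n + m`. -/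
lemma programTime_le {n m t : ℕ} (ht : t ≤ 3 * (n + 1)) :
    (2 * n + 1) + passCost n m * (1 + t * n) ≤ 100 * (n + m + 1) ^ 4 := by
  have h1 : passCost n m ≤ 20 * (n + m + 1) ^ 2 := by
    unfold passCost
    nlinarith [Nat.zero_le (n * m), Nat.zero_le (n ^ 2), Nat.zero_le (m ^ 2)]
  have h2 : 1 + t * n ≤ 4 * (n + m + 1) ^ 2 := by
    nlinarith [Nat.mul_le_mul_right n ht, Nat.zero_le (n * m), Nat.zero_le (m ^ 2)]
  have h3 : 2 * n + 1 ≤ 20 * (n + m + 1) ^ 4 := by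
    have : n + m + 1 ≤ (n + m + 1) ^ 4 := Nat.le_self_pow (by norm_num) _
    omega
  calc _ ≤ 20 * (n + m + 1) ^ 4 + (20 * (n + m + 1) ^ 2) * (4 * (n + m + 1) ^ 2) :=
        Nat.add_le_add h3 (Nat.mul_le_mul h1 h2)
    _ = _ := by ring

/-- Throwing the elements of a type into `m` bins so that no bin gets more than `K`: an upper bound
for the number of ways, obtained from the generating function of a bin. -/
lemma card_boundedFibers_mul_pow_le (K : ℕ) {x : ℝ} (hx : 0 ≤ x) (m : ℕ) (α : Type) [Fintype α]
    [DecidableEq α] :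
    ((Finset.univ.filter fun f : α → Fin m =>
        ∀ k, (Finset.univ.filter fun i => f i = k).card ≤ K).card : ℝ) * x ^ Fintype.card α ≤
      (Fintype.card α).factorial * (∑ l ∈ Finset.range (K + 1), x ^ l / l.factorial) ^ m := by
  induction m generalizing α with
  | zero =>
    rcases isEmpty_or_nonempty α with h | ⟨⟨a⟩⟩
    · simp [Finset.filter_true_of_mem]
    · have : IsEmpty (α → Fin 0) := ⟨fun f => (f a).elim0⟩
      rw [Finset.univ_eq_empty (α := α → Fin 0), Finset.filter_empty, Finset.card_empty,
        Nat.cast_zero, zero_mul]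
      positivity
  | succ m ih =>
    set E := ∑ l ∈ Finset.range (K + 1), x ^ l / l.factorial with hE
    have hE0 : 0 ≤ E := Finset.sum_nonneg fun l _ => by positivity
    set F := Finset.univ.filter fun f : α → Fin (m + 1) =>
      ∀ k, (Finset.univ.filter fun i => f i = k).card ≤ K with hF
    let G (S : Finset α) : Finset ({i // i ∉ S} → Fin m) := Finset.univ.filter fun g =>
      ∀ k, (Finset.univ.filter fun i => g i = k).card ≤ K
    -- Induction peels off bin 0: once the set `S` of its balls is fixed, the assignment is
    -- determined by its restriction to the complement, shifted down to `m` bins.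
    have hfib : ∀ S : Finset α, (F.filter fun f => (Finset.univ.filter fun i => f i = 0) = S).card ≤
        if S.card ≤ K then (G S).card else 0 := by
      intro S
      by_cases hm : (F.filter fun f => (Finset.univ.filter fun i => f i = 0) = S).card = 0
      · rw [hm]; exact Nat.zero_le _
      obtain ⟨f₀, hf₀⟩ := Finset.card_ne_zero.1 hm
      rw [Finset.mem_filter, hF, Finset.mem_filter] at hf₀
      have hS : S.card ≤ K := hf₀.2 ▸ hf₀.1.2 0
      rw [if_pos hS]
      have hne : ∀ f : {f // f ∈ F.filter fun f => (Finset.univ.filter fun i => f i = 0) = S},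
          ∀ i : {i // i ∉ S}, f.1 i ≠ 0 := by
        rintro ⟨f, hf⟩ ⟨i, hi⟩ h0
        rw [Finset.mem_filter] at hf
        exact hi (hf.2 ▸ by simpa using h0)
      rw [← Fintype.card_coe, ← Fintype.card_coe (G S)]
      refine Fintype.card_le_of_injective
        (fun f => ⟨fun i => (f.1 i).pred (hne f i), ?_⟩) ?_
      · refine Finset.mem_filter.2 ⟨Finset.mem_univ _, fun k => ?_⟩
        obtain ⟨f, hf⟩ := f
        have hfF := (Finset.mem_filter.1 (Finset.mem_filter.1 hf).1).2 k.succ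
        refine le_trans ?_ hfF
        refine Finset.card_le_card_of_injOn Subtype.val (fun i hi => ?_)
          Subtype.val_injective.injOn
        have hi' := (Finset.mem_filter.1 (Finset.mem_coe.1 hi)).2
        refine Finset.mem_coe.2 (Finset.mem_filter.2 ⟨Finset.mem_univ _, ?_⟩)
        rw [← hi', Fin.succ_pred]
      · rintro ⟨f, hf⟩ ⟨g, hg⟩ hfg
        rw [Subtype.mk.injEq] at hfg ⊢
        have hf' := (Finset.mem_filter.1 hf).2
        have hg' := (Finset.mem_filter.1 hg).2
        funext i
        by_cases hi : i ∈ S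
        · have h1 : f i = 0 := by rw [← hf'] at hi; simpa using hi
          have h2 : g i = 0 := by rw [← hg'] at hi; simpa using hi
          rw [h1, h2]
        · exact Fin.pred_inj.1 (congrFun hfg ⟨i, hi⟩)
    have hcard : F.card ≤ ∑ S ∈ (Finset.univ : Finset α).powerset,
        if S.card ≤ K then (G S).card else 0 := by
      rw [Finset.card_eq_sum_card_fiberwise (f := fun f => Finset.univ.filter fun i => f i = 0)
        (t := (Finset.univ : Finset α).powerset) fun f _ => by simp]
      exact Finset.sum_le_sum fun S _ => hfib S
    set N := Fintype.card α with hN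
    calc (F.card : ℝ) * x ^ N
        ≤ (∑ S ∈ (Finset.univ : Finset α).powerset,
            ((if S.card ≤ K then (G S).card else 0 : ℕ) : ℝ)) * x ^ N := by
          gcongr
          exact_mod_cast hcard
      _ ≤ ∑ S ∈ (Finset.univ : Finset α).powerset,
            if S.card ≤ K then x ^ S.card * ((N - S.card).factorial * E ^ m) else 0 := by
          rw [Finset.sum_mul]
          refine Finset.sum_le_sum fun S _ => ?_
          split_ifs
          · have hc : Fintype.card {i // i ∉ S} = N - S.card := by
              rw [Fintype.card_subtype_compl, Fintype.card_coe]
            have h := ih {i // i ∉ S}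
            rw [hc] at h
            have hle : S.card ≤ N := Finset.card_le_univ S
            rw [← Nat.add_sub_cancel' hle, pow_add, mul_left_comm, Nat.add_sub_cancel' hle]
            exact mul_le_mul_of_nonneg_left h (by positivity)
          · simp
      _ = ∑ l ∈ Finset.range (N + 1),
            if l ≤ K then N.factorial * E ^ m * (x ^ l / l.factorial) else 0 := by
          rw [Finset.sum_powerset_apply_card
            (fun l => if l ≤ K then x ^ l * ((N - l).factorial * E ^ m) else 0)]
          refine Finset.sum_congr rfl fun l hl => ?_
          have hl' : l ≤ N := Nat.lt_succ_iff.1 (Finset.mem_range.1 hl)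
          split_ifs
          -- There are `N.choose l` sets of size `l`, and `N.choose l * (N - l)! = N! / l!` produces
          -- the coefficient of the exponential series.
          · rw [Finset.card_univ, ← hN, nsmul_eq_mul, ← Nat.choose_mul_factorial_mul_factorial hl']
            push_cast
            field_simp
          · simp
      _ ≤ ∑ l ∈ Finset.range (K + 1), N.factorial * E ^ m * (x ^ l / l.factorial) := by
          rw [← Finset.sum_filter]
          refine Finset.sum_le_sum_of_subset_of_nonneg (fun l hl => ?_) fun l _ _ => by positivity
          rw [Finset.mem_range, Nat.lt_succ_iff]
          exact (Finset.mem_filter.1 hl).2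
      _ = N.factorial * E ^ (m + 1) := by rw [← Finset.mul_sum, ← hE, pow_succ, mul_assoc]

/-- Induction on `n` by way of `exp 1 ≤ (1 + 1 / n) ^ (n + 1)`, which comes from `log x ≥ 1 - 1 /
x`. -/
lemma factorial_mul_exp_le {n : ℕ} (hn : 1 ≤ n) :
    (n.factorial : ℝ) * Real.exp (n - 1) ≤ n * (n : ℝ) ^ n := by
  induction n, hn using Nat.le_induction with
  | base => simp
  | succ n hn ih =>
    have hn' : (0 : ℝ) < n := by exact_mod_cast hn
    have h1 : Real.exp 1 * (n : ℝ) ^ (n + 1) ≤ (n + 1 : ℝ) ^ (n + 1) := by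
      have h2 := Real.one_sub_inv_le_log_of_pos (x := (n + 1 : ℝ) / n) (by positivity)
      have h3 : 1 ≤ (n + 1 : ℝ) * Real.log ((n + 1 : ℝ) / n) := by
        have : 1 - ((n + 1 : ℝ) / n)⁻¹ = 1 / (n + 1) := by field_simp; ring
        rw [this] at h2
        calc (1 : ℝ) = (n + 1) * (1 / (n + 1)) := by field_simp
          _ ≤ _ := by gcongr
      have h4 : Real.exp 1 ≤ ((n + 1 : ℝ) / n) ^ (n + 1) := by
        rw [← Real.exp_log (x := (n + 1 : ℝ) / n) (by positivity), ← Real.exp_nat_mul]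
        push_cast
        exact Real.exp_le_exp.2 h3
      calc _ ≤ ((n + 1 : ℝ) / n) ^ (n + 1) * (n : ℝ) ^ (n + 1) := by gcongr
        _ = _ := by rw [← mul_pow, div_mul_cancel₀ _ hn'.ne']
    rw [Nat.factorial_succ]
    push_cast
    calc (n + 1 : ℝ) * n.factorial * Real.exp (n + 1 - 1)
        = (n + 1) * (Real.exp 1 * (n.factorial * Real.exp (n - 1))) := by
          rw [show (n : ℝ) + 1 - 1 = 1 + (n - 1) by ring, Real.exp_add]; ring
      _ ≤ (n + 1) * (Real.exp 1 * (n * (n : ℝ) ^ n)) := by gcongr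
      _ = (n + 1) * (Real.exp 1 * (n : ℝ) ^ (n + 1)) := by ring
      _ ≤ (n + 1) * (n + 1 : ℝ) ^ (n + 1) := by gcongr

/-! ### The Moser-Tardos algorithm on balls in bins. -/

section MoserTardos

variable {n m : ℕ}

lemma feasible_iff {b : ℝ} (hb : 0 ≤ b) (X : (ballsInBins n m).Config) :
    (ballsInBins n m).Feasible (fun _ => b) X ↔ ∀ k, binLoad X k ≤ ⌊b⌋₊ := by
  refine forall_congr' fun k => ?_
  rw [load_ballsInBins, Nat.le_floor_iff hb]

/-- Any ball could fall into bin `k`. This is what ruins MT: it redraws everything, including the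
balls outside the violated bin. -/
lemma rowVars_ballsInBins (k : Fin m) : rowVars (ballsInBins n m) k = Finset.univ :=
  Finset.filter_true_of_mem fun _ _ => ⟨k, by simp⟩

lemma initialLaw_uniformAssignment (hm : m ≠ 0) (X : Fin n → Fin m) :
    initialLaw (uniformAssignment n hm) X = ((m : ℝ≥0∞)⁻¹) ^ n := by
  change ∏ i, (uniformAssignment n hm).law i (X i) = _
  rw [Finset.prod_congr rfl fun i _ => law_uniformAssignment hm i (X i)]
  rw [Finset.prod_const, Finset.card_univ, Fintype.card_fin]

/-- All assignments have mass `m ^ (-n)`, so it suffices to count the feasible ones. The parameter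
`x` of the generating function is free; it is set to `R` later. -/
lemma initialLaw_feasible_le (hm : m ≠ 0) {b : ℝ} (hb : 0 ≤ b) {x : ℝ} (hx : 0 < x) :
    (initialLaw (uniformAssignment n hm)).toOuterMeasure
        {X | (ballsInBins n m).Feasible (fun _ => b) X} ≤
      ENNReal.ofReal (n.factorial *
        (∑ l ∈ Finset.range (⌊b⌋₊ + 1), x ^ l / l.factorial) ^ m / (x * m) ^ n) := by
  have hm' : (0 : ℝ) < m := by positivity
  let S : Finset (Fin n → Fin m) := Finset.univ.filter fun f =>
    ∀ k, (Finset.univ.filter fun i => f i = k).card ≤ ⌊b⌋₊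
  have hset : {X | (ballsInBins n m).Feasible (fun _ => b) X} = (S : Set (Fin n → Fin m)) := by
    ext X
    rw [Set.mem_ofPred_eq, feasible_iff hb]
    simp only [S, Finset.coe_filter, Finset.mem_univ, true_and]
    rfl
  rw [hset, PMF.toOuterMeasure_apply_finset,
    Finset.sum_congr rfl fun X _ => initialLaw_uniformAssignment hm X, Finset.sum_const,
    nsmul_eq_mul, ← ENNReal.ofReal_natCast m, ← ENNReal.ofReal_inv_of_pos hm',
    ← ENNReal.ofReal_pow (by positivity), ← ENNReal.ofReal_natCast S.card,
    ← ENNReal.ofReal_mul (by positivity)]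
  refine ENNReal.ofReal_le_ofReal ?_
  have h := card_boundedFibers_mul_pow_le ⌊b⌋₊ hx.le m (Fin n)
  rw [Fintype.card_fin] at h
  rw [le_div_iff₀ (by positivity), mul_pow]
  calc (S.card : ℝ) * ((m : ℝ)⁻¹) ^ n * (x ^ n * (m : ℝ) ^ n)
      = S.card * x ^ n * ((m : ℝ)⁻¹ * m) ^ n := by rw [mul_pow]; ring
    _ = S.card * x ^ n := by rw [inv_mul_cancel₀ hm'.ne', one_pow, mul_one]
    _ ≤ _ := h

/-- A union bound over the initial draw and `t` resamplings, each of which is again a draw from the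
initial law, whatever the past. -/
lemma mtTerminationProb_le (z : (ballsInBins n m).FractionalAssignment) (b : Fin m → ℝ)
    (σ : MTRule (ballsInBins n m)) (t : ℕ) :
    mtTerminationProb z b σ t ≤
      (t + 1 : ℕ) * (initialLaw z).toOuterMeasure {X | (ballsInBins n m).Feasible b X} := by
  classical
  unfold mtTerminationProb
  induction t with
  | zero =>
    rw [mtLaw, PMF.toOuterMeasure_map_apply]
    simp
  | succ t ih =>
    rw [Nat.cast_succ, add_mul, one_mul]
    refine le_trans ?_ (add_le_add_left ih _)
    rw [toOuterMeasure_eq_expect, toOuterMeasure_eq_expect (mtLaw z b σ t), mtLaw, expect_bind,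
      ← expect_const (mtLaw z b σ t) (PMF.toOuterMeasure _ _), ← expect_add]
    refine expect_mono _ fun s _ => ?_
    by_cases hs : (ballsInBins n m).Feasible b s.2
    · rw [if_pos hs, expect_pure]
      exact le_self_add
    · rw [if_neg hs, rowVars_ballsInBins, resample_univ, ← toOuterMeasure_eq_expect,
        PMF.toOuterMeasure_map_apply]
      exact le_add_self

end MoserTardos

/-! ### Exponential decay of the probability of feasibility. -/

/-- A Poisson variable is bounded by `K` with probability less than 1. -/
lemma sum_pow_div_factorial_lt_exp (K : ℕ) {x : ℝ} (hx : 0 < x) :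
    ∑ l ∈ Finset.range (K + 1), x ^ l / l.factorial < Real.exp x := by
  refine lt_of_lt_of_le ?_ (Real.sum_le_exp_of_nonneg hx.le (K + 2))
  rw [Finset.sum_range_succ _ (K + 1)]
  exact lt_add_of_pos_right _ (by positivity)

/-- Stirling's estimate turns the bound from the generating function into an exponential one. -/
lemma factorial_mul_div_le {R E : ℝ} (hE : 0 ≤ E) {n m : ℕ} (hn : 1 ≤ n)
    (h1 : (n : ℝ) ≤ R * m) (h2 : R * m ≤ n + 1) :
    n.factorial * E ^ m / (R * m) ^ n ≤
      Real.exp 2 * (R * m) * (E * Real.exp (-R)) ^ m := by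
  have hn' : (0 : ℝ) < n := by exact_mod_cast hn
  have hRm : 0 < R * m := hn'.trans_le h1
  rw [div_le_iff₀ (by positivity)]
  have h3 : (n.factorial : ℝ) ≤ Real.exp 2 * Real.exp (-R) ^ m * (n * (n : ℝ) ^ n) := by
    have h4 : (n.factorial : ℝ) ≤ Real.exp (1 - n) * (n * (n : ℝ) ^ n) := by
      have := mul_le_mul_of_nonneg_left (factorial_mul_exp_le hn) (Real.exp_pos (1 - n)).le
      rwa [mul_left_comm, ← Real.exp_add, show (1 - n + (n - 1) : ℝ) = 0 by ring, Real.exp_zero,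
        mul_one] at this
    refine h4.trans ?_
    gcongr
    -- It remains to see `1 - n ≤ 2 - R * m`, which is `h2`; the factor `exp 2` absorbs the rounding
    -- of `R * m`.
    rw [← Real.exp_nat_mul, ← Real.exp_add]
    exact Real.exp_le_exp.2 (by nlinarith)
  calc n.factorial * E ^ m
      ≤ Real.exp 2 * Real.exp (-R) ^ m * (n * (n : ℝ) ^ n) * E ^ m := by gcongr
    _ ≤ Real.exp 2 * Real.exp (-R) ^ m * ((R * m) * (R * m) ^ n) * E ^ m := by gcongr
    _ = _ := by rw [mul_pow]; ring

open Filter in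
-- Write `E * exp (-R) = r ^ 4` and `2 ^ (-φ) = r`. Of the four factors `r ^ m`, one compensates the
-- number of steps `t`, one absorbs the factor linear in `m`, and the remaining two are more than
-- the required bound `r ^ m`.
lemma exists_exponent {R E : ℝ} (hR : 1 ≤ R) (hE : 0 < E) (hER : E < Real.exp R) :
    ∃ φ : ℝ, 0 < φ ∧ ∀ᶠ m : ℕ in atTop, ∀ t : ℕ, (t : ℝ) ≤ 2 ^ (φ * m) →
      (t + 1 : ℝ) * (Real.exp 2 * (R * m) * (E * Real.exp (-R)) ^ m) ≤ 2 ^ (-(φ * m)) := by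
  set q := E * Real.exp (-R) with hq
  have hq0 : 0 < q := by positivity
  have hq1 : q < 1 := by
    rw [hq, Real.exp_neg, ← div_eq_mul_inv]
    exact (div_lt_one (Real.exp_pos R)).2 hER
  set r := q ^ (1 / 4 : ℝ) with hr
  have hr0 : 0 < r := by positivity
  have hr1 : r < 1 := Real.rpow_lt_one hq0.le hq1 (by norm_num)
  have hr4 : r ^ 4 = q := by
    rw [hr, ← Real.rpow_natCast, ← Real.rpow_mul hq0.le]
    norm_num
  refine ⟨-Real.logb 2 r, by
    rw [neg_pos]; exact Real.logb_neg (by norm_num) hr0 hr1, ?_⟩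
  have hpow : ∀ m : ℕ, (2 : ℝ) ^ (-(-Real.logb 2 r * m)) = r ^ m := fun m => by
    rw [neg_mul, neg_neg, Real.rpow_mul (by norm_num), Real.rpow_logb (by norm_num) (by norm_num)
      hr0, Real.rpow_natCast]
  have hc : 0 < 1 / (2 * Real.exp 2 * R) := by positivity
  filter_upwards [(tendsto_self_mul_const_pow_of_lt_one hr0.le hr1).eventually (gt_mem_nhds hc)]
    with m hm t ht
  have hpow' : (2 : ℝ) ^ (-Real.logb 2 r * m) = (r ^ m)⁻¹ := by
    rw [← hpow, Real.rpow_neg (by norm_num), inv_inv]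
  rw [hpow'] at ht
  rw [hpow, ← hr4, ← pow_mul, mul_comm 4 m, pow_mul]
  have hrm0 : 0 < r ^ m := by positivity
  have hrm1 : r ^ m ≤ 1 := pow_le_one₀ hr0.le hr1.le
  rw [lt_div_iff₀ (by positivity)] at hm
  have ht' : (t + 1 : ℝ) ≤ 2 * (r ^ m)⁻¹ := by
    have := (one_le_inv₀ hrm0).2 hrm1
    linarith
  calc (t + 1 : ℝ) * (Real.exp 2 * (R * m) * (r ^ m) ^ 4)
      ≤ 2 * (r ^ m)⁻¹ * (Real.exp 2 * (R * m) * (r ^ m) ^ 4) := by gcongr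
    _ = (m * r ^ m * (2 * Real.exp 2 * R)) * (r ^ m) ^ 2 := by field_simp
    _ ≤ 1 * (r ^ m) ^ 2 := by gcongr
    _ ≤ r ^ m := by nlinarith

lemma achieves_uniformAssignment {n m : ℕ} (hm : m ≠ 0) {R : ℝ} (h : (n : ℝ) ≤ R * m) :
    (uniformAssignment n hm).Achieves fun _ => R := by
  intro k
  change ∑ _ : Fin n, ∑ j : Fin m, (if j = k then (1 : ℝ) else 0) * (1 / m) ≤ R
  have hm' : (0 : ℝ) < m := by positivity
  simp only [ite_mul, one_mul, zero_mul, Finset.sum_ite_eq', Finset.mem_univ, if_true,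
    Finset.sum_const, Finset.card_univ, Fintype.card_fin, nsmul_eq_mul]
  rwa [mul_one_div, div_le_iff₀ hm']

lemma existsUnique_coeff_pos {n m : ℕ} (i : Fin n) (j : Fin m) :
    ∃! k, 0 < (ballsInBins n m).coeff k i j := by
  refine ⟨j, by simp, fun k hk => ?_⟩
  by_contra h
  have h0 : (ballsInBins n m).coeff k i j = 0 := if_neg (Ne.symm h)
  exact absurd hk h0.not_gt

end PartialResampling

end

/-! ### Choice of the parameters and conclusion. -/

theorem mainTheorem12 :
    ∃ (C c₁ c₂ : ℝ) (P : Polynomial ℕ), 0 < C ∧ 0 < c₁ ∧ 0 < c₂ ∧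
    ∀ R R' : ℝ, 1 ≤ R → R ≤ R' →
    ∃ φ φ' : ℝ, 0 < φ ∧ 0 < φ' ∧ ∃ M : ℕ, ∀ m : ℕ, M ≤ m →
    ∃ (n : ℕ) (A : AssignmentPacking n m) (z : A.FractionalAssignment),
      -- size
      c₁ * (R * m) ≤ n ∧ (n : ℝ) ≤ c₂ * (R * m) ∧
      -- every variable has `m` values, the entries are 0 or 1, and `z` is uniform
      (∀ i, A.numVals i = m) ∧
      (∀ k i j, A.coeff k i j = 0 ∨ A.coeff k i j = 1) ∧
      (∀ i j, z.val i j = 1 / m) ∧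
      -- fractional solution at level `R`
      z.Achieves (fun _ => R) ∧
      -- every column has exactly one positive entry
      (∀ i j, ∃! k, 0 < A.coeff k i j) ∧
      -- the PRA
      (∃ Q : Fin m → Finset A.Elem → ℝ≥0,
        (∀ k, IsFractionalHittingSet (Q k) (badEvents A (fun _ => R + C * √R) k)) ∧
        (∀ σ : PRARule A, σ.Valid (fun _ => R + C * √R) →
          praExpectedResamplings z (fun _ => R + C * √R) Q σ ≤ ((P.eval (n + m) : ℕ) : ℝ≥0∞)) ∧
        ∃ (T : Fin m → ℕ) (d : ℕ),
          ImplementsPRA z (fun _ => R + C * √R) Q T d ∧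
          ∀ X₀ : A.Config, praExpectedTime z T d X₀ ≤ ((P.eval (n + m) : ℕ) : ℝ≥0∞)) ∧
      -- the MT algorithm
      (∀ σ : MTRule A, σ.Valid (fun _ => R') → ∀ t : ℕ, (t : ℝ) ≤ 2 ^ (φ * m) →
        mtTerminationProb z (fun _ => R') σ t ≤ ENNReal.ofReal (2 ^ (-(φ' * m)))) := by
  refine ⟨2, 1 / 2, 1, 100 * (Polynomial.X + 1) ^ 4, by norm_num, by norm_num, by norm_num,
    fun R R' hR hRR' => ?_⟩
  have hR0 : 0 < R := zero_lt_one.trans_le hR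
  have hR'0 : 0 ≤ R' := hR0.le.trans hRR'
  obtain ⟨φ, hφ, hev⟩ := exists_exponent hR
    (E := ∑ l ∈ Finset.range (⌊R'⌋₊ + 1), R ^ l / l.factorial)
    (Finset.sum_pos (fun l _ => by positivity) ⟨0, by simp⟩)
    (sum_pow_div_factorial_lt_exp _ hR0)
  obtain ⟨M, hM⟩ := Filter.eventually_atTop.1 hev
  -- From `m ≥ 2` comes `R * m ≥ 2`, so that rounding down loses at most half: `n ≥ R * m / 2`.
  refine ⟨φ, φ, hφ, hφ, max M 2, fun m hm => ?_⟩
  have hm2 : 2 ≤ m := (le_max_right _ _).trans hm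
  have hm0 : m ≠ 0 := by omega
  have hm2' : (2 : ℝ) ≤ m := by exact_mod_cast hm2
  have hRm : 2 ≤ R * m := by nlinarith
  set n := ⌊R * m⌋₊ with hn
  have hn1 : (n : ℝ) ≤ R * m := Nat.floor_le (by linarith)
  have hn2 : R * m < n + 1 := Nat.lt_floor_add_one _
  have hn0 : 1 ≤ n := Nat.le_floor (by push_cast; linarith)
  set b := R + 2 * √R with hb
  set T := ⌊b⌋₊ with hT
  have hsqrt1 : 1 ≤ √R := Real.one_le_sqrt.2 hR
  have hsqrt2 : √R ≤ R := Real.sqrt_le_left (by linarith) |>.2 (by nlinarith)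
  have hb0 : 0 ≤ b := by linarith
  have hTb : ∀ c : ℕ, b < c ↔ T < c := fun c => (Nat.floor_lt hb0).symm
  -- This fixes `C = 2`: `T > b - 1 = R + 2√R - 1 ≥ R + 1` because `√R ≥ 1`. The margin 1 above the
  -- mean load is the drift.
  have hT1 : R + 1 ≤ T := by
    have := Nat.lt_floor_add_one b
    linarith
  have hnm : n + m ≤ T * m := by
    have : (n + m : ℝ) ≤ T * m := by nlinarith
    exact_mod_cast this
  -- `T ≤ R + 2√R ≤ 3R ≤ 3Rm`, and `R * m < n + 1`.
  have hT2 : T ≤ 3 * (n + 1) := by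
    have h1 : (T : ℝ) ≤ b := Nat.floor_le hb0
    have : (T : ℝ) ≤ 3 * (n + 1) := by nlinarith
    exact_mod_cast this
  have hP : (100 * (Polynomial.X + 1) ^ 4 : Polynomial ℕ).eval (n + m) =
      100 * (n + m + 1) ^ 4 := by simp
  have htime := programTime_le (m := m) hT2
  have hpot := isPotential_excess hm0 hTb hnm
  have hbound : ∀ X : Fin n → Fin m, (excess T X : ℝ≥0∞) ≤ (T * n : ℕ) := fun X => by
    exact_mod_cast excess_le T X
  refine ⟨n, ballsInBins n m, uniformAssignment n hm0, by linarith, by linarith, fun _ => rfl,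
    fun k i j => ?_, fun _ _ => rfl, achieves_uniformAssignment hm0 hn1, existsUnique_coeff_pos,
    ⟨fun _ => singletonHittingSet _ T, isFractionalHittingSet_singleton hTb, fun σ hσ => ?_,
      fun _ => T, 1, implementsPRA_ballsInBins _ hTb, fun X₀ => ?_⟩, fun σ _ t ht => ?_⟩
  · by_cases h : j = k
    · exact Or.inr (if_pos h)
    · exact Or.inl (if_neg h)
  · rw [hP]
    refine (praExpectedResamplings_le hpot hσ hbound).trans ?_
    -- The potential is at most the bound on the running time, so one polynomial serves for both.
    have hle : T * n ≤ passCost n m * (1 + T * n) :=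
      (Nat.le_add_left _ _).trans (Nat.le_mul_of_pos_left _ (Nat.succ_pos _))
    exact_mod_cast hle.trans ((Nat.le_add_left _ _).trans htime)
  · rw [hP]
    exact (praExpectedTime_le hpot (implementsPRA_ballsInBins _ hTb) X₀ hbound).trans
      (by exact_mod_cast htime)
  · refine (mtTerminationProb_le _ _ σ t).trans
      ((mul_le_mul_right (initialLaw_feasible_le hm0 hR'0 hR0) _).trans ?_)
    rw [← ENNReal.ofReal_natCast, ← ENNReal.ofReal_mul (by positivity)]
    refine ENNReal.ofReal_le_ofReal (le_trans ?_ (hM m ((le_max_left _ _).trans hm) t ht))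
    push_cast
    gcongr
    exact factorial_mul_div_le (Finset.sum_nonneg fun l _ => by positivity) hn0 hn1 hn2.le
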